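/- Let $a_1,a_2,a_3,a_4,q$ be indeterminates, and write $(u;q)_n=\prod_{j=0}^{n-1}(1-uq^j)$, $(u_1,\dots,u_r;q)_n=\prod_i (u_i;q)_n$ and $[n]_q!=\prod_{j=1}^n(1+q+\cdots+q^{j-1})$. With $x=\cos\theta$, let $$p_n(x;a,b,c,d|q)=\frac{(ab,ac,ad;q)_n}{2^na^n(abcdq^{n-1};q)_n}\;{}_4\phi_3\!\left(\begin{matrix}q^{-n},\,abcdq^{n-1},\,ae^{i\theta},\,ae^{-i\theta}\\ ab,\,ac,\,ad\end{matrix};q,q\right)$$ be the monic Askey--Wilson polynomials and let $$H_n(x|q)=\frac{e^{in\theta}}{2^n}\;{}_2\phi_0\!\left(\begin{matrix}q^{-n},\,0\\ -\end{matrix};q,\,q^ne^{-2i\theta}\right)$$ be the monic continuous $q$-Hermite polynomials. Define the mixed moments $\sigma^{AW,H}_{n,k}$ of the former relative to the latter by $$H_n(x|q)=\sum_{k=0}^n\sigma^{AW,H}_{n,k}(a,b,c,d;q)\,p_k(x;a,b,c,d|q),$$ and, for $n\ge k\ge0$, the rescaled mixed moments by $$\tilde\sigma^{AW,H}_{n,k}(a_1,a_2,a_3,a_4;q)=\Big(\frac{2}{\sqrt{-1}}\Big)^{n-k}\sigma^{AW,H}_{n,k}(\sqrt{-1}\,a_1,\sqrt{-1}\,a_2,\sqrt{-1}\,a_3,\sqrt{-1}\,a_4;q).$$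 Let $\mathcal T$ be the set of quadruples $T=(t_1,t_2,t_3,t_4)$ of nonnegative integers such that $|T|:=t_1+t_2+t_3+t_4$ is odd and $|t_i-t_j|\le1$ for all $i,j$. It is totally ordered by: $(t_1,t_2,t_3,t_4)\le(s_1,s_2,s_3,s_4)$ if and only if $(t_4,t_3,t_2,-t_1)\le(s_4,s_3,s_2,-s_1)$ lexicographically. For $n\ge k\ge0$ let $$\mathcal T_{n,k}=\{(T_k,T_{k+1},\dots,T_{n-1})\in\mathcal T^{n-k}:T_k\ge T_{k+1}\ge\cdots\ge T_{n-1}\}.$$ For $\mathbf T=(T_k,\dots,T_{n-1})\in\mathcal T_{n,k}$ let $s(\mathbf T)=(s_1,s_2,s_3,s_4)=T_k+\cdots+T_{n-1}$ (component-wise), $\mathbf a^{s(\mathbf T)}=a_1^{s_1}a_2^{s_2}a_3^{s_3}a_4^{s_4}$, $\|\mathbf T\|_{n,k}=\sum_{i=k}^{n-1}\frac{i(|T_i|-1)}2$, let $m(\mathbf T)=(m_1,\dots,m_r)$ be the numbers of occurrences of the distinct entries of $\mathbf T$, in the order in which these entries appear, and let $$\genfrac{[}{]}{0pt}{}{n}{k,m(\mathbf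 T)}_q=\frac{[n]_q!}{[k]_q!\,[m_1]_q!\cdots[m_r]_q!}.$$ Then, for all integers $n\ge k\ge0$, $\tilde\sigma^{AW,H}_{n,k}(a_1,a_2,a_3,a_4;q)$ is a formal power series in $a_1,a_2,a_3,a_4,q$, and $$\tilde\sigma^{AW,H}_{n,k}(a_1,a_2,a_3,a_4;q)=\sum_{\mathbf T\in\mathcal T_{n,k}}\mathbf a^{s(\mathbf T)}\,q^{\|\mathbf T\|_{n,k}}\genfrac{[}{]}{0pt}{}{n}{k,m(\mathbf T)}_q,$$ where every monomial in $a_1,a_2,a_3,a_4,q$ has a nonzero coefficient in only finitely many terms of the sum. -/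

import Mathlib

namespace AskeyWilson

open Polynomial

noncomputable section

/-! ### `q`-notation and basic hypergeometric series -/

/-- The `q`-shifted factorial `(a;q)_n = (1 - a)(1 - aq) ⋯ (1 - aq^{n-1})`. -/
def qPoch {R : Type*} [CommRing R] (a q : R) (n : ℕ) : R :=
  ∏ j ∈ Finset.range n, (1 - a * q ^ j)

/-- The `q`-factorial `[n]_q! = ∏_{j=1}^n (1 + q + ⋯ + q^{j-1})`. -/
def qFactorial {R : Type*} [CommRing R] (q : R) (n : ℕ) : R :=
  ∏ j ∈ Finset.range n, ∑ i ∈ Finset.range (j + 1), q ^ i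

/-- The basic hypergeometric series `_rφ_s(as; bs; q, z)`, where `r` and `s` are the lengths of
the lists `as` and `bs`. It is used below only for terminating series, those with an upper
parameter `q^{-n}`. -/
def qHyper {K : Type*} [Field K] (as bs : List K) (q z : K) : K :=
  ∑ᶠ k : ℕ, (as.map fun a => qPoch a q k).prod /
    ((bs.map fun b => qPoch b q k).prod * qPoch q q k) *
    ((-1) ^ k * q ^ k.choose 2) ^ (1 + (bs.length : ℤ) - (as.length : ℤ)) * z ^ k

/-! ### The two families of polynomials -/

/-- The monic Askey--Wilson polynomial
`p_n(x;a,b,c,d|q) = (ab,ac,ad;q)_n / (2^n a^n (abcdq^{n-1};q)_n) ·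
  _4φ_3(q^{-n}, abcdq^{n-1}, ae^{iθ}, ae^{-iθ}; ab, ac, ad; q, q)`, `x = cos θ`,
as a polynomial in `x`, through
`(ae^{iθ};q)_k (ae^{-iθ};q)_k = ∏_{j<k} (1 - 2aq^j x + a²q^{2j})`; see `awPoly_eval`. -/
def awPoly {K : Type*} [Field K] (a b c d q : K) (n : ℕ) : K[X] :=
  C (qPoch (a * b) q n * qPoch (a * c) q n * qPoch (a * d) q n /
      (2 ^ n * a ^ n * qPoch (a * b * c * d * q ^ ((n : ℤ) - 1)) q n)) *
    ∑ k ∈ Finset.range (n + 1),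
      C (qPoch (q ^ (-(n : ℤ))) q k * qPoch (a * b * c * d * q ^ ((n : ℤ) - 1)) q k /
          (qPoch (a * b) q k * qPoch (a * c) q k * qPoch (a * d) q k * qPoch q q k) * q ^ k) *
        ∏ j ∈ Finset.range k, (1 - C (2 * a * q ^ j) * X + C (a ^ 2 * q ^ (2 * j)))

/-- The monic continuous `q`-Hermite polynomial
`H_n(x|q) = e^{inθ} / 2^n · _2φ_0(q^{-n}, 0; -; q, q^n e^{-2iθ})`, `x = cos θ`,
as a polynomial in `x`: the coefficients of `e^{i(n-2k)θ}` and `e^{-i(n-2k)θ}` are equal, so that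
`e^{i(n-2k)θ}` may be replaced by `cos((n-2k)θ) = T_{n-2k}(x)`; see `hermitePoly_eval`. -/
def hermitePoly {K : Type*} [Field K] (q : K) (n : ℕ) : K[X] :=
  C (1 / 2 ^ n) * ∑ k ∈ Finset.range (n + 1),
    C (qPoch (q ^ (-(n : ℤ))) q k / qPoch q q k * ((-1) ^ k * q ^ k.choose 2)⁻¹ * (q ^ n) ^ k) *
      Chebyshev.T K ((n : ℤ) - 2 * k)

theorem qPoch_neg_eq_zero {K : Type*} [Field K] {q : K} (hq : q ≠ 0) {n k : ℕ} (h : n < k) :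
    qPoch (q ^ (-(n : ℤ))) q k = 0 := by
  unfold qPoch
  refine Finset.prod_eq_zero (Finset.mem_range.mpr h) ?_
  rw [zpow_neg, zpow_natCast, inv_mul_cancel₀ (pow_ne_zero _ hq), sub_self]

theorem qPoch_mul_inv {K : Type*} [Field K] (h2 : (2 : K) ≠ 0) (a q z : K) (hz : z ≠ 0) (k : ℕ) :
    qPoch (a * z) q k * qPoch (a * z⁻¹) q k =
      ∏ j ∈ Finset.range k,
        (1 - 2 * a * q ^ j * ((z + z⁻¹) / 2) + a ^ 2 * q ^ (2 * j)) := by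
  unfold qPoch
  rw [← Finset.prod_mul_distrib]
  refine Finset.prod_congr rfl fun j _ => ?_
  field_simp
  ring

/-- `awPoly` is the Askey--Wilson polynomial: with `z = e^{iθ}` and `x = (z + z⁻¹)/2`. -/
theorem awPoly_eval {K : Type*} [Field K] (h2 : (2 : K) ≠ 0) (a b c d q z : K) (hq : q ≠ 0)
    (hz : z ≠ 0) (n : ℕ) :
    (awPoly a b c d q n).eval ((z + z⁻¹) / 2) =
      qPoch (a * b) q n * qPoch (a * c) q n * qPoch (a * d) q n /
        (2 ^ n * a ^ n * qPoch (a * b * c * d * q ^ ((n : ℤ) - 1)) q n) *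
      qHyper [q ^ (-(n : ℤ)), a * b * c * d * q ^ ((n : ℤ) - 1), a * z, a * z⁻¹]
        [a * b, a * c, a * d] q q := by
  unfold awPoly qHyper
  rw [finsum_eq_sum_of_support_subset (s := Finset.range (n + 1))]
  · simp only [eval_mul, eval_C, eval_finsetSum, eval_prod, eval_add, eval_sub, eval_one, eval_X]
    congr 1
    refine Finset.sum_congr rfl fun k _ => ?_
    rw [← qPoch_mul_inv h2 a q z hz k]
    simp only [List.map_cons, List.map_nil, List.prod_cons, List.prod_nil, List.length_cons,
      List.length_nil]
    norm_num
    ring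
  · intro k hk
    simp only [Finset.coe_range, Set.mem_Iio]
    by_contra hlt
    apply hk
    simp only [List.map_cons, List.prod_cons, qPoch_neg_eq_zero hq (show n < k by omega),
      zero_mul, zero_div]

theorem chebyshev_eval {K : Type*} [Field K] (h2 : (2 : K) ≠ 0) (z : K) (hz : z ≠ 0) (m : ℤ) :
    (Chebyshev.T K m).eval ((z + z⁻¹) / 2) = (z ^ m + z ^ (-m)) / 2 := by
  induction m using Polynomial.Chebyshev.induct with
  | zero => simp; field_simp; norm_num
  | one => simp
  | add_two n ih1 ih2 =>
    rw [Chebyshev.T_add_two]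
    simp only [eval_sub, eval_mul, eval_X, eval_ofNat, ih1, ih2]
    simp only [neg_add, zpow_add₀ hz, zpow_neg, zpow_natCast, zpow_ofNat]
    field_simp
    ring
  | neg_add_one n ih1 ih2 =>
    rw [Chebyshev.T_sub_one]
    simp only [eval_sub, eval_mul, eval_X, eval_ofNat, ih1, ih2]
    simp only [neg_add, neg_neg, sub_eq_add_neg, zpow_add₀ hz, zpow_neg, zpow_natCast,
      zpow_one]
    field_simp
    ring

theorem qPoch_self_ne_zero {K : Type*} [Field K] {q : K} (h : ∀ m : ℕ, q ^ (m + 1) ≠ 1) (n : ℕ) :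
    qPoch q q n ≠ 0 := by
  unfold qPoch
  refine Finset.prod_ne_zero_iff.mpr fun j _ => ?_
  rw [← pow_succ', sub_ne_zero]
  exact (h j).symm

theorem hermite_coeff {K : Type*} [Field K] {q : K} (hq : q ≠ 0)
    (h : ∀ m : ℕ, q ^ (m + 1) ≠ 1) {n k : ℕ} (hk : k ≤ n) :
    qPoch (q ^ (-(n : ℤ))) q k / qPoch q q k * ((-1) ^ k * q ^ k.choose 2)⁻¹ * (q ^ n) ^ k =
      qPoch q q n / (qPoch q q k * qPoch q q (n - k)) := by
  have key : ∀ k ≤ n, qPoch (q ^ (-(n : ℤ))) q k * (q ^ n) ^ k * qPoch q q (n - k) =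
      qPoch q q n * ((-1) ^ k * q ^ k.choose 2) := by
    intro k
    induction k with
    | zero => intro _; simp [qPoch]
    | succ k ih =>
      intro hk
      have ih' := ih (by omega)
      obtain ⟨m, rfl⟩ : ∃ m, n = k + 1 + m := ⟨n - (k + 1), by omega⟩
      have e1 : k + 1 + m - k = m + 1 := by omega
      have e2 : k + 1 + m - (k + 1) = m := by omega
      rw [e1] at ih'
      rw [e2]
      have s1 : qPoch q q (m + 1) = qPoch q q m * (1 - q * q ^ m) := by
        simp [qPoch, Finset.prod_range_succ]
      have s2 : qPoch (q ^ (-((k + 1 + m : ℕ) : ℤ))) q (k + 1) =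
          qPoch (q ^ (-((k + 1 + m : ℕ) : ℤ))) q k *
            (1 - q ^ (-((k + 1 + m : ℕ) : ℤ)) * q ^ k) := by
        simp [qPoch, Finset.prod_range_succ]
      have s3 : (1 - q ^ (-((k + 1 + m : ℕ) : ℤ)) * q ^ k) * q ^ (k + 1 + m) =
          -(q ^ k * (1 - q * q ^ m)) := by
        rw [zpow_neg, zpow_natCast]
        field_simp
        ring
      rw [s1] at ih'
      have s4 : (k + 1).choose 2 = k + k.choose 2 := by
        rw [Nat.choose_succ_succ' k 1, Nat.choose_one_right]
      rw [s2, s4, pow_succ (q ^ (k + 1 + m)) k]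
      calc _ = qPoch (q ^ (-((k + 1 + m : ℕ) : ℤ))) q k * (q ^ (k + 1 + m)) ^ k * qPoch q q m *
            ((1 - q ^ (-((k + 1 + m : ℕ) : ℤ)) * q ^ k) * q ^ (k + 1 + m)) := by ring
        _ = -q ^ k * (qPoch (q ^ (-((k + 1 + m : ℕ) : ℤ))) q k * (q ^ (k + 1 + m)) ^ k *
            (qPoch q q m * (1 - q * q ^ m))) := by rw [s3]; ring
        _ = _ := by rw [ih']; ring
  have hk1 := qPoch_self_ne_zero h k
  have hk2 := qPoch_self_ne_zero h (n - k)
  have hs : ((-1) ^ k * q ^ k.choose 2 : K) ≠ 0 :=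
    mul_ne_zero (pow_ne_zero _ (by simp)) (pow_ne_zero _ hq)
  rw [div_mul_eq_mul_div, div_mul_eq_mul_div, div_eq_div_iff hk1 (mul_ne_zero hk1 hk2)]
  have := key k hk
  calc _ = (qPoch (q ^ (-(n : ℤ))) q k * (q ^ n) ^ k * qPoch q q (n - k)) *
        ((-1) ^ k * q ^ k.choose 2)⁻¹ * qPoch q q k := by ring
    _ = _ := by rw [this, mul_inv_cancel_right₀ hs]

/-- `hermitePoly` is the continuous `q`-Hermite polynomial: with `z = e^{iθ}` and
`x = (z + z⁻¹)/2`. -/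
theorem hermitePoly_eval {K : Type*} [Field K] (h2 : (2 : K) ≠ 0) (q z : K) (hq : q ≠ 0)
    (h : ∀ m : ℕ, q ^ (m + 1) ≠ 1) (hz : z ≠ 0) (n : ℕ) :
    (hermitePoly q n).eval ((z + z⁻¹) / 2) =
      z ^ n / 2 ^ n * qHyper [q ^ (-(n : ℤ)), 0] [] q (q ^ n * z ^ (-2 : ℤ)) := by
  unfold hermitePoly qHyper
  rw [finsum_eq_sum_of_support_subset (s := Finset.range (n + 1))]
  · simp only [eval_mul, eval_C, eval_finsetSum, chebyshev_eval h2 z hz]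
    have e1 : ∑ k ∈ Finset.range (n + 1), qPoch (q ^ (-(n : ℤ))) q k / qPoch q q k *
          ((-1) ^ k * q ^ k.choose 2)⁻¹ * (q ^ n) ^ k *
            ((z ^ ((n : ℤ) - 2 * k) + z ^ (-((n : ℤ) - 2 * k))) / 2) =
        ∑ k ∈ Finset.range (n + 1), qPoch q q n / (qPoch q q k * qPoch q q (n - k)) *
            ((z ^ ((n : ℤ) - 2 * k) + z ^ (-((n : ℤ) - 2 * k))) / 2) := by
      refine Finset.sum_congr rfl fun k hk => ?_
      rw [hermite_coeff hq h (by simpa [Nat.lt_succ_iff] using hk)]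
    have e2 : ∑ k ∈ Finset.range (n + 1), qPoch q q n / (qPoch q q k * qPoch q q (n - k)) *
          z ^ (-((n : ℤ) - 2 * k)) =
        ∑ k ∈ Finset.range (n + 1), qPoch q q n / (qPoch q q k * qPoch q q (n - k)) *
          z ^ ((n : ℤ) - 2 * k) := by
      rw [← Finset.sum_range_reflect]
      refine Finset.sum_congr rfl fun k hk => ?_
      have hk' : k ≤ n := by simpa [Nat.lt_succ_iff] using hk
      rw [show n + 1 - 1 - k = n - k by omega, show n - (n - k) = k by omega,
        mul_comm (qPoch q q k), Nat.cast_sub hk']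
      congr 2
      ring
    have e3 : ∑ k ∈ Finset.range (n + 1), qPoch q q n / (qPoch q q k * qPoch q q (n - k)) *
          ((z ^ ((n : ℤ) - 2 * k) + z ^ (-((n : ℤ) - 2 * k))) / 2) =
        ∑ k ∈ Finset.range (n + 1), qPoch q q n / (qPoch q q k * qPoch q q (n - k)) *
          z ^ ((n : ℤ) - 2 * k) := by
      have : ∀ A B : K, A = B → (A + B) / 2 = A := by
        rintro A _ rfl; field_simp; norm_num
      rw [← this _ _ e2.symm, ← Finset.sum_add_distrib, Finset.sum_div]
      exact Finset.sum_congr rfl fun k _ => by ring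
    rw [e1, e3, Finset.mul_sum, Finset.mul_sum]
    refine Finset.sum_congr rfl fun k hk => ?_
    rw [← hermite_coeff hq h (by simpa [Nat.lt_succ_iff] using hk)]
    have hz0 : qPoch (0 : K) q k = 1 := by simp [qPoch]
    have hzp : z ^ ((n : ℤ) - 2 * k) = z ^ n * (z ^ (-2 : ℤ)) ^ k := by
      rw [← zpow_natCast, ← zpow_natCast, ← zpow_mul, ← zpow_add₀ hz]
      congr 1
    simp only [List.map_cons, List.map_nil, List.prod_cons, List.prod_nil, List.length_cons,
      List.length_nil, hz0, hzp]
    norm_num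
    ring
  · intro k hk
    simp only [Finset.coe_range, Set.mem_Iio]
    by_contra hlt
    apply hk
    simp only [List.map_cons, List.prod_cons, qPoch_neg_eq_zero hq (show n < k by omega),
      zero_mul, zero_div]

/-! ### Mixed moments -/

/-- The mixed moments `σ_{n,k}` of a sequence `p` of polynomials with `deg p_n = n` relative to a
sequence `r`: the coefficients in `r_n = ∑_k σ_{n,k} p_k`. (The value is `0` if `deg p_n = n`
fails for some `n`.) -/
def mixedMoment {K : Type*} [Field K] (p r : ℕ → K[X]) (n k : ℕ) : K :=
  open Classical in
  if h : ∀ m : ℕ, (p m).degree = m then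
    ((⟨p, h⟩ : Polynomial.Sequence K).basis
      (fun m => ((leadingCoeff_ne_zero.mpr (Sequence.ne_zero ⟨p, h⟩ m)).isUnit))).repr (r n) k
  else 0

theorem eq_sum_mixedMoment {K : Type*} [Field K] {p r : ℕ → K[X]}
    (hp : ∀ m : ℕ, (p m).degree = m) {n : ℕ} (hr : (r n).degree ≤ n) :
    r n = ∑ k ∈ Finset.range (n + 1), C (mixedMoment p r n k) * p k := by
  set S : Polynomial.Sequence K := ⟨p, hp⟩ with hS
  have hu : ∀ m, IsUnit (S m).leadingCoeff := fun m =>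
    (leadingCoeff_ne_zero.mpr (S.ne_zero m)).isUnit
  have hmem : r n ∈ Submodule.span K (S.basis hu '' Set.Iic n) := by
    have h1 : (S.basis hu '' Set.Iic n) = S '' Set.Iic n :=
      Set.image_congr fun i _ => S.basis_eq_self hu i
    rw [h1, S.span_degreeLE (fun i _ => hu i)]
    exact mem_degreeLE.mpr hr
  have hsup : ((S.basis hu).repr (r n)).support ⊆ Finset.range (n + 1) := by
    intro i hi
    have := (S.basis hu).repr_support_subset_of_mem_span _ hmem hi
    simpa [Nat.lt_succ_iff] using this
  conv_lhs => rw [← (S.basis hu).linearCombination_repr (r n)]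
  rw [Finsupp.linearCombination_apply, Finsupp.sum_of_support_subset _ hsup _ (by simp)]
  refine Finset.sum_congr rfl fun k _ => ?_
  rw [S.basis_eq_self, mixedMoment, dif_pos hp, smul_eq_C_mul]

theorem mixedMoment_unique {K : Type*} [Field K] {p r : ℕ → K[X]}
    (hp : ∀ m : ℕ, (p m).degree = m) {n : ℕ} {s : ℕ → K}
    (hs : r n = ∑ k ∈ Finset.range (n + 1), C (s k) * p k) {k : ℕ} (hk : k ≤ n) :
    mixedMoment p r n k = s k := by
  set S : Polynomial.Sequence K := ⟨p, hp⟩ with hS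
  have hu : ∀ m, IsUnit (S m).leadingCoeff := fun m =>
    (leadingCoeff_ne_zero.mpr (S.ne_zero m)).isUnit
  have h1 : mixedMoment p r n k = (S.basis hu).repr (r n) k := by
    rw [mixedMoment, dif_pos hp]
  have h2 : r n = ∑ k ∈ Finset.range (n + 1), s k • S.basis hu k := by
    rw [hs]
    exact Finset.sum_congr rfl fun k _ => by rw [S.basis_eq_self, smul_eq_C_mul]
  rw [h1, h2, map_sum, Finset.sum_apply']
  simp only [map_smul, Module.Basis.repr_self, Finsupp.smul_single, smul_eq_mul, mul_one,
    Finsupp.single_apply]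
  rw [Finset.sum_ite_eq' (Finset.range (n + 1)) k s, if_pos (by simpa [Nat.lt_succ_iff] using hk)]

/-- The mixed moments `σ^{AW,H}_{n,k}(a,b,c,d;q)` of the Askey--Wilson polynomials relative to the
continuous `q`-Hermite polynomials: `H_n(x|q) = ∑_k σ^{AW,H}_{n,k}(a,b,c,d;q) p_k(x;a,b,c,d|q)`. -/
def sigmaAWH {K : Type*} [Field K] (a b c d q : K) (n k : ℕ) : K :=
  mixedMoment (awPoly a b c d q) (hermitePoly q) n k

theorem qPoch_ne_zero {K : Type*} [Field K] {u q : K} (h : ∀ m : ℕ, u * q ^ m ≠ 1) (n : ℕ) :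
    qPoch u q n ≠ 0 :=
  Finset.prod_ne_zero_iff.mpr fun j _ => sub_ne_zero.mpr (h j).symm

theorem degree_C_mul_le {K : Type*} [Field K] (c : K) (p : K[X]) :
    (C c * p).degree ≤ p.degree := by
  rw [← smul_eq_C_mul]
  exact degree_smul_le c p

/-- For generic parameters, `p_n(x;a,b,c,d|q)` has degree `n`. -/
theorem awPoly_degree {K : Type*} [Field K] (h2 : (2 : K) ≠ 0) {a b c d q : K} (ha : a ≠ 0)
    (hq : q ≠ 0) (hq1 : ∀ m : ℕ, q ^ (m + 1) ≠ 1) (hab : ∀ m : ℕ, a * b * q ^ m ≠ 1)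
    (hac : ∀ m : ℕ, a * c * q ^ m ≠ 1) (had : ∀ m : ℕ, a * d * q ^ m ≠ 1)
    (habcd : ∀ m : ℕ, a * b * c * d * q ^ m ≠ 1) (n : ℕ) :
    (awPoly a b c d q n).degree = n := by
  have hzq : ∀ n : ℕ, qPoch (a * b * c * d * q ^ ((n : ℤ) - 1)) q n ≠ 0 := by
    intro n
    cases n with
    | zero => simp [qPoch]
    | succ m =>
      refine qPoch_ne_zero (fun j => ?_) _
      have : ((m + 1 : ℕ) : ℤ) - 1 = (m : ℤ) := by push_cast; ring
      rw [this, zpow_natCast, mul_assoc, ← pow_add]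
      exact habcd _
  have hqn : qPoch (q ^ (-(n : ℤ))) q n ≠ 0 := by
    refine Finset.prod_ne_zero_iff.mpr fun j hj => sub_ne_zero.mpr fun e => ?_
    obtain ⟨m, rfl⟩ : ∃ m, n = j + (m + 1) := ⟨n - j - 1, by
      have := Finset.mem_range.mp hj; omega⟩
    rw [zpow_neg, zpow_natCast, eq_comm, inv_mul_eq_one₀ (pow_ne_zero _ hq), pow_add] at e
    exact hq1 m (mul_left_cancel₀ (pow_ne_zero j hq) (by rw [e, mul_one]))
  have hfac : ∀ k : ℕ, (∏ j ∈ Finset.range k,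
      (1 - C (2 * a * q ^ j) * X + C (a ^ 2 * q ^ (2 * j)) : K[X])).degree = k := by
    intro k
    rw [degree_prod]
    have : ∀ j : ℕ, (1 - C (2 * a * q ^ j) * X + C (a ^ 2 * q ^ (2 * j)) : K[X]).degree = 1 := by
      intro j
      have e : (1 - C (2 * a * q ^ j) * X + C (a ^ 2 * q ^ (2 * j)) : K[X]) =
          C (-(2 * a * q ^ j)) * X + C (1 + a ^ 2 * q ^ (2 * j)) := by
        simp only [C_neg, C_add, C_1]; ring
      rw [e]
      exact degree_linear (neg_ne_zero.mpr (mul_ne_zero (mul_ne_zero h2 ha) (pow_ne_zero _ hq)))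
    rw [Finset.sum_congr rfl fun j _ => this j]
    simp
  unfold awPoly
  rw [degree_C_mul, Finset.sum_range_succ, degree_add_eq_right_of_degree_lt]
  · rw [degree_C_mul, hfac]
    refine mul_ne_zero (div_ne_zero (mul_ne_zero hqn (hzq n)) ?_) (pow_ne_zero _ hq)
    exact mul_ne_zero (mul_ne_zero (mul_ne_zero (qPoch_ne_zero hab n) (qPoch_ne_zero hac n))
      (qPoch_ne_zero had n)) (qPoch_self_ne_zero hq1 n)
  · rw [degree_C_mul, hfac]
    · refine (degree_sum_le _ _).trans_lt ((Finset.sup_lt_iff (WithBot.bot_lt_coe n)).mpr ?_)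
      intro k hk
      refine (AskeyWilson.degree_C_mul_le _ _).trans_lt ?_
      rw [hfac]
      exact WithBot.coe_lt_coe.mpr (Finset.mem_range.mp hk)
    refine mul_ne_zero (div_ne_zero (mul_ne_zero hqn (hzq n)) ?_) (pow_ne_zero _ hq)
    exact mul_ne_zero (mul_ne_zero (mul_ne_zero (qPoch_ne_zero hab n) (qPoch_ne_zero hac n))
      (qPoch_ne_zero had n)) (qPoch_self_ne_zero hq1 n)
  · refine div_ne_zero (mul_ne_zero (mul_ne_zero (qPoch_ne_zero hab n) (qPoch_ne_zero hac n))
      (qPoch_ne_zero had n)) ?_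
    exact mul_ne_zero (mul_ne_zero (pow_ne_zero _ h2) (pow_ne_zero _ ha)) (hzq n)

theorem hermitePoly_degree_le {K : Type*} [Field K] (h2 : (2 : K) ≠ 0) (q : K) (n : ℕ) :
    (hermitePoly q n).degree ≤ n := by
  have : NeZero (2 : K) := ⟨h2⟩
  unfold hermitePoly
  refine (AskeyWilson.degree_C_mul_le _ _).trans ((degree_sum_le _ _).trans (Finset.sup_le fun k hk => ?_))
  refine (AskeyWilson.degree_C_mul_le _ _).trans ?_
  rw [Chebyshev.degree_T]
  have := Finset.mem_range.mp hk
  exact_mod_cast (show ((n : ℤ) - 2 * k).natAbs ≤ n by omega)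

/-! ### Formal power series in `a₁, a₂, a₃, a₄, q` -/

/-- Formal power series in the five variables `a₁, a₂, a₃, a₄` (indices `0,1,2,3`) and `q`
(index `4`). -/
abbrev Ser : Type := MvPowerSeries (Fin 5) ℂ

/-- The field of fractions of `Ser`; it contains all rational functions in `a₁, a₂, a₃, a₄, q`. -/
abbrev SerFrac : Type := FractionRing Ser

def varA (j : Fin 4) : Ser := MvPowerSeries.X j.castSucc

def varQ : Ser := MvPowerSeries.X (Fin.last 4)

def imag : SerFrac := algebraMap Ser SerFrac (MvPowerSeries.C Complex.I)

/-- `√-1 · a_j`. -/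
def scaledA (j : Fin 4) : SerFrac := imag * algebraMap Ser SerFrac (varA j)

/-- The rescaled mixed moments
`(2/√-1)^{n-k} σ^{AW,H}_{n,k}(√-1 a₁, √-1 a₂, √-1 a₃, √-1 a₄; q)`. -/
def rescaledMoment (n k : ℕ) : SerFrac :=
  (2 / imag) ^ (n - k) *
    sigmaAWH (scaledA 0) (scaledA 1) (scaledA 2) (scaledA 3) (algebraMap Ser SerFrac varQ) n k

theorem algebraMap_ne_one {f : Ser} (h : MvPowerSeries.constantCoeff f = 0) :
    algebraMap Ser SerFrac f ≠ 1 := by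
  intro e
  rw [← map_one (algebraMap Ser SerFrac)] at e
  have := IsFractionRing.injective Ser SerFrac e
  rw [this] at h
  simp at h

/-- The degree condition in the definition of the mixed moments holds for the parameters
`√-1 a_j` and `q`. -/
theorem awPoly_scaled_degree (n : ℕ) :
    (awPoly (scaledA 0) (scaledA 1) (scaledA 2) (scaledA 3)
      (algebraMap Ser SerFrac varQ) n).degree = n := by
  have hinj : Function.Injective (algebraMap Ser SerFrac) := IsFractionRing.injective Ser SerFrac
  have hX : ∀ i : Fin 5, (MvPowerSeries.X i : Ser) ≠ 0 := fun i e => by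
    have := congrArg (MvPowerSeries.coeff (Finsupp.single i 1)) e
    simp [MvPowerSeries.coeff_X] at this
  have hC : (MvPowerSeries.C Complex.I : Ser) ≠ 0 := fun e => by
    have := congrArg MvPowerSeries.constantCoeff e
    simp at this
  have hs : ∀ j, scaledA j = algebraMap Ser SerFrac (MvPowerSeries.C Complex.I * varA j) :=
    fun j => by rw [map_mul]; rfl
  have h2 : (2 : SerFrac) ≠ 0 := by
    have h2' : (2 : Ser) ≠ 0 := fun e => by
      have := congrArg MvPowerSeries.constantCoeff e
      rw [map_ofNat, map_zero] at this
      exact two_ne_zero this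
    have := hinj.ne h2'
    rwa [map_ofNat, map_zero] at this
  have cA : ∀ j, MvPowerSeries.constantCoeff (varA j) = 0 := fun j => by simp [varA]
  refine awPoly_degree h2 ?_ ?_ (fun m => ?_) (fun m => ?_) (fun m => ?_) (fun m => ?_)
    (fun m => ?_) n
  · rw [hs, ← map_zero (algebraMap Ser SerFrac)]
    exact hinj.ne (mul_ne_zero hC (hX _))
  · rw [← map_zero (algebraMap Ser SerFrac)]
    exact hinj.ne (hX _)
  · rw [← map_pow]
    exact algebraMap_ne_one (by simp [varQ])
  all_goals
    simp only [hs, ← map_mul, ← map_pow]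
    exact algebraMap_ne_one (by simp [cA])

/-- The expansion defining the mixed moments `σ^{AW,H}_{n,k}(√-1 a₁, …, √-1 a₄; q)` holds. -/
theorem hermitePoly_eq_sum (n : ℕ) :
    hermitePoly (algebraMap Ser SerFrac varQ) n = ∑ k ∈ Finset.range (n + 1),
      C (sigmaAWH (scaledA 0) (scaledA 1) (scaledA 2) (scaledA 3)
        (algebraMap Ser SerFrac varQ) n k) *
      awPoly (scaledA 0) (scaledA 1) (scaledA 2) (scaledA 3) (algebraMap Ser SerFrac varQ) k := by
  have h2 : (2 : SerFrac) ≠ 0 := by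
    have h2' : (2 : Ser) ≠ 0 := fun e => by
      have := congrArg MvPowerSeries.constantCoeff e
      rw [map_ofNat, map_zero] at this
      exact two_ne_zero this
    have := (IsFractionRing.injective Ser SerFrac).ne h2'
    rwa [map_ofNat, map_zero] at this
  exact eq_sum_mixedMoment awPoly_scaled_degree (hermitePoly_degree_le h2 _ n)

/-- The family `f` of power series is formally summable with sum `F`: every monomial has a nonzero
coefficient in only finitely many `f i`, and `F` collects these coefficients. -/
def IsFormalSum {ι : Type*} (f : ι → Ser) (F : Ser) : Prop :=
  ∀ e : Fin 5 →₀ ℕ, (Function.support fun i => MvPowerSeries.coeff e (f i)).Finite ∧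
    MvPowerSeries.coeff e F = ∑ᶠ i, MvPowerSeries.coeff e (f i)

/-! ### The ordered set of quadruples -/

/-- Quadruples `(t₁,t₂,t₃,t₄)` (here `t 0, …, t 3`) of nonnegative integers with odd sum whose
entries differ by at most `1`. -/
@[ext] structure Quad where
  t : Fin 4 → ℕ
  odd_sum : Odd (∑ j, t j)
  close : ∀ i j, |(t i : ℤ) - (t j : ℤ)| ≤ 1

/-- The key `(t₄, t₃, t₂, -t₁)`, with the lexicographic order on keys. -/
def Quad.key (T : Quad) : ℕ ×ₗ ℕ ×ₗ ℕ ×ₗ ℤ :=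
  toLex (T.t 3, toLex (T.t 2, toLex (T.t 1, -(T.t 0 : ℤ))))

theorem Quad.key_injective : Function.Injective Quad.key := by
  intro S T h
  simp only [Quad.key, EmbeddingLike.apply_eq_iff_eq, Prod.mk.injEq, neg_inj, Nat.cast_inj] at h
  ext j
  fin_cases j
  · exact h.2.2.2
  · exact h.2.2.1
  · exact h.2.1
  · exact h.1

/-- `S ≤ T` if and only if `(s₄,s₃,s₂,-s₁) ≤ (t₄,t₃,t₂,-t₁)` lexicographically. -/
instance : LinearOrder Quad := LinearOrder.lift' Quad.key Quad.key_injective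

/-- `|T| = t₁ + t₂ + t₃ + t₄`. -/
def Quad.total (T : Quad) : ℕ := ∑ j, T.t j

/-- The weakly decreasing tuples `(T_k ≥ T_{k+1} ≥ ⋯ ≥ T_{n-1})`, indexed from `k` to `n - 1`. -/
def Chain (n k : ℕ) : Type := {T : Finset.Ico k n → Quad // Antitone T}

variable {n k : ℕ}

/-- The component-wise sum `s(T) = T_k + ⋯ + T_{n-1}`. -/
def Chain.s (T : Chain n k) (j : Fin 4) : ℕ := ∑ i : Finset.Ico k n, (T.1 i).t j

/-- `‖T‖_{n,k} = ∑_{i=k}^{n-1} i(|T_i| - 1)/2`, where `|T_i|` is odd. -/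
def Chain.norm (T : Chain n k) : ℕ := ∑ i : Finset.Ico k n, (i : ℕ) * (((T.1 i).total - 1) / 2)

/-- The multiplicities `m(T) = (m₁,…,m_r)`: how often each of the distinct entries of `T` occurs,
the entries being listed in decreasing order. -/
def Chain.m (T : Chain n k) : List ℕ :=
  ((Finset.univ.image T.1).sort (· ≥ ·)).map fun S => (Finset.univ.filter fun i => T.1 i = S).card

/-- `[n]_q! / ([k]_q! [m₁]_q! ⋯ [m_r]_q!)` as a power series in `q`; the denominator has constant
coefficient `1`. -/
def qMultinomial (n k : ℕ) (m : List ℕ) : Ser :=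
  qFactorial varQ n * (qFactorial varQ k * (m.map (qFactorial varQ)).prod)⁻¹

end

end AskeyWilson

namespace AskeyWilson

open Polynomial

noncomputable section

/-! ### Gaussian binomial coefficients -/

section QBinom

variable {R : Type*} [CommRing R]

/-- The Gaussian binomial coefficient. -/
def qBinom (q : R) : ℕ → ℕ → R
  | _, 0 => 1
  | 0, _ + 1 => 0
  | n + 1, k + 1 => qBinom q n k + q ^ (k + 1) * qBinom q n (k + 1)

variable (q : R)

@[simp] theorem qBinom_zero_right (n : ℕ) : qBinom q n 0 = 1 := by
  cases n <;> rfl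

theorem qBinom_zero_succ (k : ℕ) : qBinom q 0 (k + 1) = 0 := rfl

theorem qBinom_succ_succ (n k : ℕ) :
    qBinom q (n + 1) (k + 1) = qBinom q n k + q ^ (k + 1) * qBinom q n (k + 1) := rfl

theorem qBinom_eq_zero {n k : ℕ} (h : n < k) : qBinom q n k = 0 := by
  induction n generalizing k with
  | zero => obtain ⟨k, rfl⟩ := Nat.exists_eq_succ_of_ne_zero h.ne'; rfl
  | succ n ih =>
    obtain ⟨k, rfl⟩ := Nat.exists_eq_succ_of_ne_zero (Nat.ne_zero_of_lt h)
    rw [Nat.succ_eq_add_one, qBinom_succ_succ, ih (by omega), ih (by omega)]; ring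

@[simp] theorem qBinom_self (n : ℕ) : qBinom q n n = 1 := by
  induction n with
  | zero => rfl
  | succ n ih => rw [qBinom_succ_succ, ih, qBinom_eq_zero q (Nat.lt_succ_self n)]; ring

theorem one_sub_mul_qBinom_succ_right (k m : ℕ) :
    (1 - q ^ (k + 1)) * qBinom q (k + m) (k + 1) = (1 - q ^ m) * qBinom q (k + m) k := by
  obtain ⟨n, hn⟩ : ∃ n, n = k + m := ⟨_, rfl⟩
  induction n generalizing k m with
  | zero =>
    obtain ⟨rfl, rfl⟩ : k = 0 ∧ m = 0 := by omega
    simp [qBinom_zero_succ]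
  | succ n ih =>
    cases k with
    | zero =>
      have := ih 0 n (by omega)
      rw [← hn, qBinom_succ_succ]
      obtain rfl : m = n + 1 := by omega
      simp only [zero_add, qBinom_zero_right, pow_one, mul_one] at this ⊢
      linear_combination q * this
    | succ k =>
      rw [← hn, qBinom_succ_succ, qBinom_succ_succ]
      have h1 := ih k m (by omega)
      have e1 : k + m = n := by omega
      rw [e1] at h1
      cases m with
      | zero =>
        rw [qBinom_eq_zero q (show n < k + 1 + 1 by omega),
          qBinom_eq_zero q (show n < k + 1 by omega)]
        ring
      | succ m =>
        have h2 := ih (k + 1) m (by omega)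
        rw [show k + 1 + m = n by omega] at h2
        linear_combination q ^ (k + 1 + 1) * h2 + h1

theorem one_sub_mul_qBinom_succ_succ (n k : ℕ) :
    (1 - q ^ (k + 1)) * qBinom q (n + 1) (k + 1) = (1 - q ^ (n + 1)) * qBinom q n k := by
  rcases le_or_gt k n with h | h
  · obtain ⟨m, rfl⟩ := Nat.exists_eq_add_of_le h
    have := one_sub_mul_qBinom_succ_right q k m
    rw [qBinom_succ_succ]
    linear_combination q ^ (k + 1) * this
  · rw [qBinom_eq_zero q h, qBinom_eq_zero q (show n + 1 < k + 1 by omega)]; ring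

theorem qBinom_succ_succ' (k m : ℕ) :
    qBinom q (k + m + 1) (k + 1) = q ^ m * qBinom q (k + m) k + qBinom q (k + m) (k + 1) := by
  have := one_sub_mul_qBinom_succ_right q k m
  rw [qBinom_succ_succ]
  linear_combination -this

theorem qFactorial_zero : qFactorial q 0 = 1 := by simp [qFactorial]

theorem qFactorial_succ (n : ℕ) :
    qFactorial q (n + 1) = qFactorial q n * ∑ i ∈ Finset.range (n + 1), q ^ i := by
  simp [qFactorial, Finset.prod_range_succ]

theorem qBinom_mul_qFactorial (k m : ℕ) :
    qBinom q (k + m) k * (qFactorial q k * qFactorial q m) = qFactorial q (k + m) := by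
  obtain ⟨n, hn⟩ : ∃ n, n = k + m := ⟨_, rfl⟩
  induction n generalizing k m with
  | zero =>
    obtain ⟨rfl, rfl⟩ : k = 0 ∧ m = 0 := by omega
    simp [qFactorial_zero]
  | succ n ih =>
    rcases k with _ | k
    · simp [qFactorial_zero]
    rcases m with _ | m
    · simp [qFactorial_zero]
    have h1 := ih k (m + 1) (by omega)
    have h2 := ih (k + 1) m (by omega)
    have e : ∑ i ∈ Finset.range (n + 1), q ^ i = ∑ i ∈ Finset.range (k + 1), q ^ i +
        q ^ (k + 1) * ∑ i ∈ Finset.range (m + 1), q ^ i := by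
      rw [show n + 1 = (k + 1) + (m + 1) by omega, Finset.sum_range_add, Finset.mul_sum]
      simp [pow_add]
    rw [show k + (m + 1) = n by omega] at h1
    rw [show k + 1 + m = n by omega] at h2
    rw [← hn, qBinom_succ_succ, qFactorial_succ q n, e]
    have e1 := qFactorial_succ q k
    have e2 := qFactorial_succ q m
    rw [e2] at h1 ⊢
    rw [e1] at h2 ⊢
    linear_combination (∑ i ∈ Finset.range (k + 1), q ^ i) * h1 +
      q ^ (k + 1) * (∑ i ∈ Finset.range (m + 1), q ^ i) * h2

theorem qFactorial_mul_one_sub_pow (n : ℕ) :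
    qFactorial q n * (1 - q) ^ n = qPoch q q n := by
  induction n with
  | zero => simp [qFactorial, qPoch]
  | succ n ih =>
    rw [qFactorial_succ, pow_succ, qPoch, Finset.prod_range_succ, ← qPoch, ← ih, ← pow_succ',
      ← mul_neg_geom_sum]
    ring

theorem qBinom_mul_qBinom [IsDomain R] {q : R} (hq : ∀ n, qFactorial q n ≠ 0) (k i m : ℕ) :
    qBinom q (k + (i + m)) (k + i) * qBinom q (k + i) k =
      qBinom q (k + (i + m)) k * qBinom q (i + m) i := by
  have h1 := qBinom_mul_qFactorial q (k + i) m
  have h2 := qBinom_mul_qFactorial q k i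
  have h3 := qBinom_mul_qFactorial q k (i + m)
  have h4 := qBinom_mul_qFactorial q i m
  rw [add_assoc] at h1
  refine mul_right_cancel₀ (mul_ne_zero (mul_ne_zero (hq k) (hq i)) (hq m)) ?_
  linear_combination h1 - h3 - qBinom q (k + (i + m)) k * qFactorial q k * h4 +
    qBinom q (k + (i + m)) (k + i) * qFactorial q m * h2

theorem qBinom_map {S : Type*} [CommRing S] (f : R →+* S) (n k : ℕ) :
    f (qBinom q n k) = qBinom (f q) n k := by
  induction n generalizing k with
  | zero => cases k <;> simp [qBinom_zero_succ]
  | succ n ih => cases k <;> simp [qBinom_succ_succ, ih]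

/-- The `q`-binomial theorem. -/
theorem sum_qBinom_mul_prod (y : R) (m : ℕ) :
    ∑ i ∈ Finset.range (m + 1), qBinom q m i * ∏ l ∈ Finset.range i, (y * q ^ l) =
      ∏ l ∈ Finset.range m, (1 + y * q ^ l) := by
  induction m with
  | zero => simp
  | succ m ih =>
    rw [Finset.prod_range_succ, ← ih, Finset.sum_range_succ']
    have h : ∀ i ∈ Finset.range (m + 1),
        qBinom q (m + 1) (i + 1) * ∏ l ∈ Finset.range (i + 1), (y * q ^ l) =
        y * q ^ m * (qBinom q m i * ∏ l ∈ Finset.range i, (y * q ^ l)) +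
          qBinom q m (i + 1) * ∏ l ∈ Finset.range (i + 1), (y * q ^ l) := by
      intro i hi
      obtain ⟨r, rfl⟩ := Nat.exists_eq_add_of_le (Nat.lt_succ_iff.mp (Finset.mem_range.mp hi))
      rw [qBinom_succ_succ', Finset.prod_range_succ]
      ring
    have h' := Finset.sum_range_succ'
      (fun i => qBinom q m i * ∏ l ∈ Finset.range i, (y * q ^ l)) (m + 1)
    rw [Finset.sum_range_succ, qBinom_eq_zero q (Nat.lt_succ_self m)] at h'
    rw [Finset.sum_congr rfl h, Finset.sum_add_distrib, ← Finset.mul_sum]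
    simp only [qBinom_zero_right, Finset.range_zero, Finset.prod_empty] at h' ⊢
    linear_combination -h'

/-- The finite form of Cauchy's identity `∑ u^i q^{i(i-1)} / ((q;q)_i (u;q)_i) = 1/(u;q)_∞`. -/
theorem sum_qBinom_mul_prod_sq (u : R) (m : ℕ) :
    ∑ i ∈ Finset.range (m + 1), qBinom q m i * (∏ l ∈ Finset.range i, (u * q ^ (2 * l))) *
      ∏ l ∈ Finset.Ico i m, (1 - u * q ^ l) = 1 := by
  induction m with
  | zero => simp
  | succ m ih =>
    set T : ℕ → ℕ → R := fun m i => qBinom q m i * (∏ l ∈ Finset.range i, (u * q ^ (2 * l))) *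
      ∏ l ∈ Finset.Ico i m, (1 - u * q ^ l) with hT
    change ∑ i ∈ Finset.range (m + 1), T m i = 1 at ih
    change ∑ i ∈ Finset.range (m + 1 + 1), T (m + 1) i = 1
    have h0 : T (m + 1) 0 = (1 - u * q ^ m) * T m 0 := by
      simp [hT, Finset.prod_range_succ, mul_comm]
    have hlast : T m (m + 1) = 0 := by
      simp [hT, qBinom_eq_zero q (Nat.lt_succ_self m)]
    have h : ∀ i ∈ Finset.range (m + 1), T (m + 1) (i + 1) =
        (1 - u * q ^ (m + (i + 1))) * T m (i + 1) + u * q ^ (m + i) * T m i := by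
      intro i hi
      obtain ⟨r, rfl⟩ := Nat.exists_eq_add_of_le (Nat.lt_succ_iff.mp (Finset.mem_range.mp hi))
      rcases r with _ | r
      · rw [add_zero] at hlast ⊢
        rw [hlast]
        simp only [hT, qBinom_self, Finset.Ico_self, Finset.prod_empty, Finset.prod_range_succ]
        ring
      · have e1 := one_sub_mul_qBinom_succ_right q i (r + 1)
        simp only [hT]
        rw [Finset.prod_eq_prod_Ico_succ_bot (show i < i + (r + 1) by omega),
          Finset.prod_Ico_succ_top (show i + 1 ≤ i + (r + 1) by omega),
          qBinom_succ_succ', Finset.prod_range_succ]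
        linear_combination -(u ^ 2 * q ^ (3 * i + r + 1) *
          (∏ l ∈ Finset.range i, (u * q ^ (2 * l))) *
            ∏ l ∈ Finset.Ico (i + 1) (i + (r + 1)), (1 - u * q ^ l)) * e1
    have h' := Finset.sum_range_succ' (fun i => (1 - u * q ^ (m + i)) * T m i) (m + 1)
    rw [Finset.sum_range_succ, hlast] at h'
    rw [Finset.sum_range_succ', Finset.sum_congr rfl h, Finset.sum_add_distrib, h0]
    have e : ∑ i ∈ Finset.range (m + 1), (1 - u * q ^ (m + i)) * T m i =
        ∑ i ∈ Finset.range (m + 1), T m i -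
          ∑ i ∈ Finset.range (m + 1), u * q ^ (m + i) * T m i := by
      rw [← Finset.sum_sub_distrib]
      exact Finset.sum_congr rfl fun i _ => by ring
    rw [add_zero] at h'
    linear_combination -h' + e + ih

end QBinom

/-! ### Lower triangular arrays -/

section Triangular

variable {R : Type*} [CommRing R]

/-- The product of infinite lower triangular matrices. -/
def triMul (f g : ℕ → ℕ → R) (n k : ℕ) : R :=
  ∑ j ∈ Finset.range (n + 1), f n j * g j k

def IsLower (f : ℕ → ℕ → R) : Prop := ∀ ⦃n k⦄, n < k → f n k = 0

theorem IsLower.triMul {f g : ℕ → ℕ → R} (hg : IsLower g) :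
    IsLower (triMul f g) := fun n k h =>
  Finset.sum_eq_zero fun j hj => by
    rw [hg (show j < k by have := Finset.mem_range.mp hj; omega), mul_zero]

theorem IsLower.sum_range {f : ℕ → ℕ → R} (hf : IsLower f) {n m : ℕ} (h : n ≤ m)
    (g : ℕ → R) :
    ∑ j ∈ Finset.range (n + 1), f n j * g j = ∑ j ∈ Finset.range (m + 1), f n j * g j := by
  refine Finset.sum_subset (Finset.range_mono (by omega)) fun j _ hj => ?_
  rw [hf (show n < j by rw [Finset.mem_range] at hj; omega), zero_mul]

theorem triMul_assoc (f : ℕ → ℕ → R) {g : ℕ → ℕ → R} (hg : IsLower g) (h : ℕ → ℕ → R) :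
    triMul (triMul f g) h = triMul f (triMul g h) := by
  funext n k
  simp only [triMul, Finset.sum_mul]
  rw [Finset.sum_comm]
  refine Finset.sum_congr rfl fun j hj => ?_
  rw [hg.sum_range (Nat.lt_succ_iff.mp (Finset.mem_range.mp hj)), Finset.mul_sum]
  exact Finset.sum_congr rfl fun i _ => mul_assoc _ _ _

/-- The matrix with entries `[n choose k]_q ∏_{k ≤ i < n} g_i`. -/
def qBinomMat (q : R) (g : ℕ → R) (n k : ℕ) : R :=
  qBinom q n k * ∏ i ∈ Finset.Ico k n, g i

/-- The matrix with entries `[n choose k]_q ∏_{k ≤ i < n} g_i / (w q^{2k}; q)_{n-k}`. -/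
def qBinomDivMat (q w : R) (g : ℕ → R) (n k : ℕ) : R :=
  qBinomMat q g n k * Ring.inverse (∏ j ∈ Finset.range (n - k), (1 - w * q ^ (2 * k + j)))

theorem isLower_qBinomMat (q : R) (g : ℕ → R) : IsLower (qBinomMat q g) := fun n k h => by
  rw [qBinomMat, qBinom_eq_zero q h, zero_mul]

theorem isLower_qBinomDivMat (q w : R) (g : ℕ → R) : IsLower (qBinomDivMat q w g) :=
  fun n k h => by rw [qBinomDivMat, isLower_qBinomMat q g h, zero_mul]

theorem qBinomDivMat_self (q w : R) (g : ℕ → R) (n : ℕ) : qBinomDivMat q w g n n = 1 := by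
  simp [qBinomDivMat, qBinomMat]

theorem qBinomMat_mul (q : R) (g h : ℕ → R) (n k : ℕ) :
    qBinomMat q (fun i => g i * h i) n k = qBinomMat q g n k * ∏ i ∈ Finset.Ico k n, h i := by
  rw [qBinomMat, Finset.prod_mul_distrib, qBinomMat, mul_assoc]

theorem qBinomDivMat_mul (q w : R) (g h : ℕ → R) (n k : ℕ) :
    qBinomDivMat q w (fun i => g i * h i) n k =
      qBinomDivMat q w g n k * ∏ i ∈ Finset.Ico k n, h i := by
  rw [qBinomDivMat, qBinomMat_mul, qBinomDivMat]; ring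

theorem sum_qBinom_mul_qBinom [IsDomain R] {q : R} (hq : ∀ n, qFactorial q n ≠ 0) (k m : ℕ)
    (X : ℕ → R) :
    ∑ j ∈ Finset.range (k + m + 1), qBinom q (k + m) j * qBinom q j k * X j =
      qBinom q (k + m) k * ∑ i ∈ Finset.range (m + 1), qBinom q m i * X (k + i) := by
  rw [add_assoc, Finset.sum_range_add, Finset.mul_sum, Finset.sum_eq_zero, zero_add]
  · refine Finset.sum_congr rfl fun i hi => ?_
    obtain ⟨r, rfl⟩ := Nat.exists_eq_add_of_le (Nat.lt_succ_iff.mp (Finset.mem_range.mp hi))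
    rw [qBinom_mul_qBinom hq, mul_assoc]
  · intro j hj
    rw [qBinom_eq_zero q (Finset.mem_range.mp hj)]; ring

theorem qBinomMat_triMul [IsDomain R] {q : R} (hq : ∀ n, qFactorial q n ≠ 0) (g : ℕ → R) (y : R) :
    triMul (qBinomMat q g) (qBinomMat q fun i => g i * (y * q ^ i)) =
      qBinomMat q fun i => g i * (1 + y * q ^ i) := by
  funext n k
  rcases lt_or_ge n k with h | h
  · rw [(isLower_qBinomMat q _).triMul h, isLower_qBinomMat q _ h]
  obtain ⟨m, rfl⟩ := Nat.exists_eq_add_of_le h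
  have e : triMul (qBinomMat q g) (qBinomMat q fun i => g i * (y * q ^ i)) (k + m) k =
      ∑ j ∈ Finset.range (k + m + 1), qBinom q (k + m) j * qBinom q j k *
        ((∏ i ∈ Finset.Ico k (k + m), g i) * ∏ i ∈ Finset.Ico k j, (y * q ^ i)) := by
    refine Finset.sum_congr rfl fun j hj => ?_
    rw [qBinomMat_mul, qBinomMat, qBinomMat]
    rcases lt_or_ge j k with hjk | hjk
    · rw [qBinom_eq_zero q hjk]; ring
    · rw [← Finset.prod_Ico_consecutive g hjk (Nat.lt_succ_iff.mp (Finset.mem_range.mp hj))]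
      ring
  rw [e, sum_qBinom_mul_qBinom hq, qBinomMat_mul, qBinomMat, mul_assoc]
  congr 1
  have h1 : ∏ i ∈ Finset.Ico k (k + m), (1 + y * q ^ i) =
      ∏ l ∈ Finset.range m, (1 + y * q ^ k * q ^ l) := by
    rw [Finset.prod_Ico_eq_prod_range, Nat.add_sub_cancel_left]
    simp only [pow_add, mul_assoc]
  rw [h1, ← sum_qBinom_mul_prod, Finset.mul_sum]
  refine Finset.sum_congr rfl fun i _ => ?_
  rw [Finset.prod_Ico_eq_prod_range (fun i => y * q ^ i), Nat.add_sub_cancel_left]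
  simp only [pow_add, mul_assoc]
  ring

theorem qBinomDivMat_eq_triMul [IsDomain R] {q : R} (hq : ∀ n, qFactorial q n ≠ 0) {w : R}
    (hw : ∀ j, IsUnit (1 - w * q ^ j)) (g : ℕ → R) :
    triMul (qBinomMat q g) (qBinomDivMat q w fun i => g i * (w * q ^ (2 * i))) =
      qBinomDivMat q w g := by
  funext n k
  rcases lt_or_ge n k with h | h
  · rw [(isLower_qBinomDivMat q w _).triMul h, isLower_qBinomDivMat q w _ h]
  obtain ⟨m, rfl⟩ := Nat.exists_eq_add_of_le h
  have e : triMul (qBinomMat q g) (qBinomDivMat q w fun i => g i * (w * q ^ (2 * i))) (k + m) k =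
      ∑ j ∈ Finset.range (k + m + 1), qBinom q (k + m) j * qBinom q j k *
        ((∏ i ∈ Finset.Ico k (k + m), g i) * ((∏ i ∈ Finset.Ico k j, (w * q ^ (2 * i))) *
          Ring.inverse (∏ j ∈ Finset.range (j - k), (1 - w * q ^ (2 * k + j))))) := by
    refine Finset.sum_congr rfl fun j hj => ?_
    rw [qBinomDivMat, qBinomMat_mul, qBinomMat, qBinomMat]
    rcases lt_or_ge j k with hjk | hjk
    · rw [qBinom_eq_zero q hjk]; ring
    · rw [← Finset.prod_Ico_consecutive g hjk (Nat.lt_succ_iff.mp (Finset.mem_range.mp hj))]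
      ring
  rw [e, sum_qBinom_mul_qBinom hq, qBinomDivMat, qBinomMat, mul_assoc, Nat.add_sub_cancel_left]
  congr 1
  have hu : ∀ s : Finset ℕ, IsUnit (∏ j ∈ s, (1 - w * q ^ (2 * k + j))) := fun s =>
    Finset.prod_induction _ IsUnit (fun _ _ => IsUnit.mul) isUnit_one fun j _ => hw _
  have hs := sum_qBinom_mul_prod_sq q (w * q ^ (2 * k)) m
  refine (hu (Finset.range m)).mul_right_cancel ?_
  rw [mul_assoc, Ring.inverse_mul_cancel _ (hu _), Finset.sum_mul]
  refine Eq.trans ?_ (congrArg (fun t => (∏ i ∈ Finset.Ico k (k + m), g i) * t) hs)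
  rw [Finset.mul_sum]
  refine Finset.sum_congr rfl fun i hi => ?_
  rw [Nat.add_sub_cancel_left, Finset.prod_Ico_eq_prod_range (fun i => w * q ^ (2 * i)),
    Nat.add_sub_cancel_left, ← Finset.prod_range_mul_prod_Ico (fun j => 1 - w * q ^ (2 * k + j))
      (Nat.lt_succ_iff.mp (Finset.mem_range.mp hi))]
  have hc := Ring.inverse_mul_cancel _ (hu (Finset.range i))
  simp only [mul_add, pow_add, mul_assoc] at hc ⊢
  linear_combination (qBinom q m i * (∏ i ∈ Finset.Ico k (k + m), g i) *
    (∏ l ∈ Finset.range i, (w * (q ^ (2 * k) * q ^ (2 * l)))) *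
    ∏ j ∈ Finset.Ico i m, (1 - w * (q ^ (2 * k) * q ^ j))) * hc

end Triangular

/-! ### Connection coefficients of the Askey--Wilson polynomials -/

section Connection

section QPoch

variable {R : Type*} [CommRing R] (a q : R)

@[simp] theorem qPoch_zero : qPoch a q 0 = 1 := by simp [qPoch]

theorem qPoch_succ (n : ℕ) : qPoch a q (n + 1) = qPoch a q n * (1 - a * q ^ n) := by
  rw [qPoch, Finset.prod_range_succ, ← qPoch]

theorem qPoch_add (m n : ℕ) : qPoch a q (m + n) = qPoch a q m * qPoch (a * q ^ m) q n := by
  simp only [qPoch, Finset.prod_range_add, pow_add, mul_assoc]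

theorem qPoch_succ' (n : ℕ) : qPoch a q (n + 1) = (1 - a) * qPoch (a * q) q n := by
  rw [add_comm, qPoch_add, qPoch_succ]; simp

theorem prod_Ico_one_sub (k m : ℕ) :
    ∏ i ∈ Finset.Ico k (k + m), (1 - a * q ^ i) = qPoch (a * q ^ k) q m := by
  rw [Finset.prod_Ico_eq_prod_range, Nat.add_sub_cancel_left, qPoch]
  simp only [pow_add, mul_assoc]

/-- `(u q^{i-1}; q)_i`. -/
def qPochShift (u : R) : ℕ → R
  | 0 => 1
  | i + 1 => qPoch (u * q ^ i) q (i + 1)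

end QPoch

variable {K : Type*} [Field K]

theorem sum_qBinom_eq_one {q S T : K} (h : ∀ l : ℕ, S * T * q ^ l ≠ 1) (m : ℕ) :
    ∑ i ∈ Finset.range (m + 1), qBinom q m i * (S ^ (m - i) * qPoch (T * q ^ i) q (m - i) *
      qPoch S q i / (qPoch (S * T * q ^ (2 * i)) q (m - i) * qPochShift q (S * T) i)) = 1 := by
  set F : ℕ → ℕ → K := fun m i => qBinom q m i * (S ^ (m - i) * qPoch (T * q ^ i) q (m - i) *
      qPoch S q i / (qPoch (S * T * q ^ (2 * i)) q (m - i) * qPochShift q (S * T) i)) with hF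
  set G : ℕ → ℕ → K := fun m i => qBinom q m i * S ^ (m - i) * qPoch (T * q ^ i) q (m - i) *
    qPoch S q (i + 1) / qPoch (S * T * q ^ i) q (m + 1) with hG
  have hne : ∀ i m : ℕ, qPoch (S * T * q ^ i) q m ≠ 0 := fun i m =>
    qPoch_ne_zero (fun j => by rw [mul_assoc, ← pow_add]; exact h _) m
  have hne' : ∀ i : ℕ, 1 - S * T * q ^ i ≠ 0 := fun i => sub_ne_zero.mpr (h i).symm
  have h0 : ∀ m, F (m + 1) 0 = F m 0 - G m 0 := by
    intro m
    have e1 := hne 0 m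
    have e2 := hne' m
    simp only [pow_zero, mul_one] at e1
    simp only [hF, hG, qBinom_zero_right, pow_zero, mul_zero, mul_one, Nat.sub_zero, qPochShift,
      qPoch_succ _ _ m, qPoch_zero, zero_add, qPoch_succ _ _ 0, one_mul, pow_succ]
    field_simp
    ring
  have hFe : ∀ j r, F (j + 1 + r) (j + 1) = qBinom q (j + 1 + r) (j + 1) * (S ^ r *
      qPoch (T * q ^ (j + 1)) q r * qPoch S q (j + 1) * (1 - S * T * q ^ (2 * j + 1)) /
        qPoch (S * T * q ^ j) q (j + 1 + r + 1)) := by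
    intro j r
    have e : qPoch (S * T * q ^ j) q (j + 1 + r + 1) = qPoch (S * T * q ^ j) q (j + 1) *
        ((1 - S * T * q ^ (2 * j + 1)) * qPoch (S * T * q ^ (2 * (j + 1))) q r) := by
      rw [show j + 1 + r + 1 = (j + 1) + (r + 1) by omega, qPoch_add, qPoch_succ' _ _ r]
      ring_nf
    have e1 := hne j (j + 1)
    have e2 := hne' (2 * j + 1)
    have e3 := hne (2 * (j + 1)) r
    simp only [hF, Nat.add_sub_cancel_left, qPochShift, e]
    generalize qPoch (S * T * q ^ j) q (j + 1) = Z at *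
    generalize 1 - S * T * q ^ (2 * j + 1) = Y at *
    generalize qPoch (S * T * q ^ (2 * (j + 1))) q r = X at *
    field_simp
  have hs : ∀ j r, F (j + r + 1) (j + 1) = F (j + r) (j + 1) + (G (j + r) j - G (j + r) (j + 1)) := by
    intro j r
    rcases r with _ | r
    · have e1 : F j (j + 1) = 0 := by
        simp only [hF, qBinom_eq_zero q (Nat.lt_succ_self j), zero_mul]
      have e2 : G j (j + 1) = 0 := by
        simp only [hG, qBinom_eq_zero q (Nat.lt_succ_self j), zero_mul, zero_div]
      have e3 := hne j (j + 1)
      have e4 := hne' (2 * j + 1)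
      rw [add_zero, e1, e2, show j + 1 = j + 1 + 0 from rfl, hFe]
      simp only [hG, qBinom_self, Nat.sub_self, pow_zero, qPoch_zero, add_zero]
      rw [qPoch_succ _ _ (j + 1)]
      have : S * T * q ^ j * q ^ (j + 1) = S * T * q ^ (2 * j + 1) := by ring
      rw [this]
      field_simp
      ring
    · have e1 := hFe j (r + 1)
      have e2 := hFe j r
      rw [show j + (r + 1) = j + 1 + r by omega, show j + 1 + r + 1 = j + 1 + (r + 1) by omega,
        e1, e2]
      simp only [hG]
      rw [show j + 1 + r - j = r + 1 by omega, Nat.add_sub_cancel_left]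
      have d1 : qPoch (S * T * q ^ j) q (j + 1 + (r + 1) + 1) =
          (1 - S * T * q ^ j) * qPoch (S * T * q ^ (j + 1)) q (j + 1 + r + 1) := by
        rw [show j + 1 + (r + 1) + 1 = (j + 1 + r + 1) + 1 by omega, qPoch_succ']
        ring_nf
      have d2 : (1 - S * T * q ^ j) * qPoch (S * T * q ^ (j + 1)) q (j + 1 + r + 1) =
          qPoch (S * T * q ^ j) q (j + 1 + r + 1) * (1 - S * T * q ^ (2 * j + r + 2)) := by
        rw [← d1, show j + 1 + (r + 1) + 1 = (j + 1 + r + 1) + 1 by omega, qPoch_succ]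
        ring_nf
      have n1 := hne' j
      have n2 := hne (j + 1) (j + 1 + r + 1)
      have n3 := hne j (j + 1 + r + 1)
      have n4 := hne' (2 * j + r + 2)
      have b1 := qBinom_succ_succ' q j (r + 1)
      have b2 := one_sub_mul_qBinom_succ_right q j (r + 1)
      rw [show j + (r + 1) = j + 1 + r by omega] at b1 b2
      rw [← add_assoc (j + 1) r 1, b1]
      have p1 : qPoch (T * q ^ (j + 1)) q (r + 1) =
          qPoch (T * q ^ (j + 1)) q r * (1 - T * q ^ (j + 1 + r)) := by
        rw [qPoch_succ]; ring_nf
      have p2 : qPoch (T * q ^ j) q (r + 1) = (1 - T * q ^ j) * qPoch (T * q ^ (j + 1)) q r := by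
        rw [qPoch_succ']; ring_nf
      have d3 : qPoch (S * T * q ^ (j + 1)) q (j + 1 + r + 1) =
          qPoch (S * T * q ^ j) q (j + 1 + r + 1) * (1 - S * T * q ^ (2 * j + r + 2)) /
            (1 - S * T * q ^ j) := by
        rw [← d2, mul_div_cancel_left₀ _ n1]
      rw [← add_assoc (j + 1) r 1] at d1
      rw [d1, d2, p1, p2, qPoch_succ S q (j + 1), d3]
      have core : (q ^ (r + 1) * qBinom q (j + 1 + r) j + qBinom q (j + 1 + r) (j + 1)) * S *
            (1 - T * q ^ (j + 1 + r)) * (1 - S * T * q ^ (2 * j + 1)) -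
          qBinom q (j + 1 + r) (j + 1) * (1 - S * T * q ^ (2 * j + 1)) *
            (1 - S * T * q ^ (2 * j + r + 2)) -
          qBinom q (j + 1 + r) j * S * (1 - T * q ^ j) * (1 - S * T * q ^ (2 * j + r + 2)) +
          qBinom q (j + 1 + r) (j + 1) * (1 - S * q ^ (j + 1)) * (1 - S * T * q ^ j) = 0 := by
        linear_combination (S - S * T * q ^ j * (1 + q ^ (r + 1)) +
          S ^ 2 * T ^ 2 * q ^ (2 * j) * q ^ (j + 1) * q ^ (r + 1)) * b2
      clear d1 d2 d3 p1 p2 e1 e2 b1 b2 n2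
      generalize qPoch (S * T * q ^ j) q (j + 1 + r + 1) = Z at *
      generalize qPoch (T * q ^ (j + 1)) q r = Y at *
      generalize qPoch S q (j + 1) = Y' at *
      generalize qBinom q (j + 1 + r) (j + 1) = B at *
      generalize qBinom q (j + 1 + r) j = B' at *
      generalize 1 - S * T * q ^ (2 * j + r + 2) = N4 at *
      generalize 1 - S * T * q ^ j = N1 at *
      generalize 1 - S * T * q ^ (2 * j + 1) = c at *
      rw [← sub_eq_zero]
      refine Eq.trans ?_ ((congrArg (fun t => S ^ r * Y * Y' / (Z * N4) * t) core).trans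
        (mul_zero _))
      field_simp
      ring
  have key : ∀ m, ∑ i ∈ Finset.range (m + 1), F m i = 1 := by
    intro m
    induction m with
    | zero => simp [hF, qPochShift]
    | succ m ih =>
      have e : ∀ i ∈ Finset.range (m + 1), F (m + 1) (i + 1) =
          F m (i + 1) + (G m i - G m (i + 1)) := by
        intro i hi
        obtain ⟨r, rfl⟩ := Nat.exists_eq_add_of_le (Nat.lt_succ_iff.mp (Finset.mem_range.mp hi))
        exact hs i r
      have e1 : F m (m + 1) = 0 := by
        simp only [hF, qBinom_eq_zero q (Nat.lt_succ_self m), zero_mul]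
      have e2 : G m (m + 1) = 0 := by
        simp only [hG, qBinom_eq_zero q (Nat.lt_succ_self m), zero_mul, zero_div]
      have h' := Finset.sum_range_succ' (fun i => F m i) (m + 1)
      rw [Finset.sum_range_succ, e1] at h'
      rw [Finset.sum_range_succ', Finset.sum_congr rfl e, Finset.sum_add_distrib,
        Finset.sum_range_sub', h0, e2]
      linear_combination ih - h'
  exact key m

end Connection

section Connection

variable {K : Type*} [Field K]

theorem qFactorial_ne_zero {q : K} (hq1 : ∀ m : ℕ, q ^ (m + 1) ≠ 1) (n : ℕ) :
    qFactorial q n ≠ 0 := fun h =>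
  qPoch_self_ne_zero hq1 n (by rw [← qFactorial_mul_one_sub_pow, h, zero_mul])

theorem hermite_coeff_eq_qBinom {q : K} (hq1 : ∀ m : ℕ, q ^ (m + 1) ≠ 1) {n k : ℕ} (hk : k ≤ n) :
    qPoch q q n / (qPoch q q k * qPoch q q (n - k)) = qBinom q n k := by
  obtain ⟨m, rfl⟩ := Nat.exists_eq_add_of_le hk
  have h := qBinom_mul_qFactorial q k m
  rw [Nat.add_sub_cancel_left, div_eq_iff (mul_ne_zero (qPoch_self_ne_zero hq1 _)
    (qPoch_self_ne_zero hq1 _)), ← qFactorial_mul_one_sub_pow, ← qFactorial_mul_one_sub_pow,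
    ← qFactorial_mul_one_sub_pow, ← h]
  ring

theorem qPoch_zpow_neg {q : K} (hq : q ≠ 0) (hq1 : ∀ m : ℕ, q ^ (m + 1) ≠ 1) {n k : ℕ}
    (hk : k ≤ n) :
    qPoch (q ^ (-(n : ℤ))) q k =
      qBinom q n k * qPoch q q k * ((-1) ^ k * q ^ k.choose 2) / (q ^ n) ^ k := by
  rw [← hermite_coeff_eq_qBinom hq1 hk, ← hermite_coeff hq hq1 hk]
  have h1 := qPoch_self_ne_zero hq1 k
  have h2 : ((-1 : K) ^ k) ≠ 0 := pow_ne_zero _ (by simp)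
  field_simp

theorem qPoch_mul_zpow {q : K} (w : K) (l i : ℕ) :
    qPoch (w * q ^ (((l + i : ℕ) : ℤ) - 1)) q (l + i) =
      qPoch (w * q ^ (((l + i : ℕ) : ℤ) - 1)) q l * qPochShift q (w * q ^ (2 * l)) i := by
  rcases i with _ | i
  · simp [qPochShift]
  · have : ((l + (i + 1) : ℕ) : ℤ) - 1 = ((l + i : ℕ) : ℤ) := by push_cast; ring
    rw [qPoch_add, this, zpow_natCast, qPochShift]
    congr 2
    ring

/-- The coefficients of `awPoly` relative to `∏_{j<l} (1 - 2aq^j x + a²q^{2j})`. -/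
def awCoeff (a b c d q : K) (n l : ℕ) : K :=
  (∏ i ∈ Finset.Ico l n, ((1 - a * b * q ^ i) * (1 - a * c * q ^ i) * (1 - a * d * q ^ i))) /
    ((2 * a) ^ n * qPochShift q (a * b * c * d * q ^ (2 * l)) (n - l)) *
    ((-1) ^ l * q ^ l.choose 2 * q ^ l / (q ^ n) ^ l)

theorem awPoly_eq {a b c d q : K} (hq : q ≠ 0)
    (hq1 : ∀ m : ℕ, q ^ (m + 1) ≠ 1) (hab : ∀ m : ℕ, a * b * q ^ m ≠ 1)
    (hac : ∀ m : ℕ, a * c * q ^ m ≠ 1) (had : ∀ m : ℕ, a * d * q ^ m ≠ 1)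
    (hw : ∀ m : ℕ, a * b * c * d * q ^ m ≠ 1) (n : ℕ) :
    awPoly a b c d q n = ∑ l ∈ Finset.range (n + 1),
      C (qBinom q n l * awCoeff a b c d q n l) *
        ∏ j ∈ Finset.range l, (1 - C (2 * a * q ^ j) * X + C (a ^ 2 * q ^ (2 * j))) := by
  rw [awPoly, Finset.mul_sum]
  refine Finset.sum_congr rfl fun l hl => ?_
  rw [← mul_assoc, ← C_mul]
  congr 2
  have hl' := Nat.lt_succ_iff.mp (Finset.mem_range.mp hl)
  rw [qPoch_zpow_neg hq hq1 hl', awCoeff, Finset.prod_mul_distrib, Finset.prod_mul_distrib]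
  obtain ⟨i, rfl⟩ := Nat.exists_eq_add_of_le hl'
  have e : ∀ u : K, qPoch u q (l + i) =
      qPoch u q l * ∏ j ∈ Finset.Ico l (l + i), (1 - u * q ^ j) := fun u => by
    rw [qPoch_add, prod_Ico_one_sub]
  rw [qPoch_mul_zpow, e, e, e, Nat.add_sub_cancel_left]
  have h1 := qPoch_ne_zero hab l
  have h2 := qPoch_ne_zero hac l
  have h3 := qPoch_ne_zero had l
  have h4 := qPoch_self_ne_zero hq1 l
  have h5 : qPoch (a * b * c * d * q ^ (((l + i : ℕ) : ℤ) - 1)) q l ≠ 0 := by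
    rcases l with _ | l
    · simp
    · refine qPoch_ne_zero (fun j => ?_) _
      rw [show ((l + 1 + i : ℕ) : ℤ) - 1 = ((l + i : ℕ) : ℤ) by push_cast; ring, zpow_natCast,
        mul_assoc, ← pow_add]
      exact hw _
  generalize qPoch (a * b * c * d * q ^ (((l + i : ℕ) : ℤ) - 1)) q l = Z at *
  generalize qPochShift q (a * b * c * d * q ^ (2 * l)) i = Y at *
  generalize qPoch (a * b) q l = A1 at *
  generalize qPoch (a * c) q l = A2 at *
  generalize qPoch (a * d) q l = A3 at *
  generalize qPoch q q l = A4 at *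
  generalize ∏ j ∈ Finset.Ico l (l + i), (1 - a * b * q ^ j) = P1
  generalize ∏ j ∈ Finset.Ico l (l + i), (1 - a * c * q ^ j) = P2
  generalize ∏ j ∈ Finset.Ico l (l + i), (1 - a * d * q ^ j) = P3
  generalize qBinom q (l + i) l = B
  rw [mul_pow 2 a]
  generalize (2 : K) ^ (l + i) * a ^ (l + i) = D
  rcases eq_or_ne D 0 with rfl | hD
  · simp
  rcases eq_or_ne Y 0 with rfl | hY
  · simp
  field_simp

theorem awPoly_comm_bd (a b c d q : K) (n : ℕ) : awPoly a b c d q n = awPoly a d c b q n := by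
  simp only [awPoly]
  rw [show a * d * c * b = a * b * c * d by ring]
  refine congrArg₂ (fun x y => C x * y) (by ring) (Finset.sum_congr rfl fun k _ => ?_)
  refine congrArg₂ (fun x y => C x * y) (by ring) rfl

theorem awPoly_comm_cd (a b c d q : K) (n : ℕ) : awPoly a b c d q n = awPoly a b d c q n := by
  simp only [awPoly]
  rw [show a * b * d * c = a * b * c * d by ring]
  refine congrArg₂ (fun x y => C x * y) (by ring) (Finset.sum_congr rfl fun k _ => ?_)
  refine congrArg₂ (fun x y => C x * y) (by ring) rfl

/-- The connection coefficients that introduce the parameter `d`. -/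
theorem awPoly_connection (h2 : (2 : K) ≠ 0) {a b c d q : K} (ha : a ≠ 0) (hq : q ≠ 0)
    (hq1 : ∀ m : ℕ, q ^ (m + 1) ≠ 1) (hab : ∀ m : ℕ, a * b * q ^ m ≠ 1)
    (hac : ∀ m : ℕ, a * c * q ^ m ≠ 1) (had : ∀ m : ℕ, a * d * q ^ m ≠ 1)
    (hw : ∀ m : ℕ, a * b * c * d * q ^ m ≠ 1) (n : ℕ) :
    awPoly a b c 0 q n = ∑ k ∈ Finset.range (n + 1),
      C (qBinomDivMat q (a * b * c * d) (fun i => d / 2 * (1 - a * b * q ^ i) *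
        (1 - a * c * q ^ i) * (1 - b * c * q ^ i)) n k) * awPoly a b c d q k := by
  set M := qBinomDivMat q (a * b * c * d) (fun i => d / 2 * (1 - a * b * q ^ i) *
        (1 - a * c * q ^ i) * (1 - b * c * q ^ i)) with hM
  have e : ∀ k ∈ Finset.range (n + 1), C (M n k) * awPoly a b c d q k =
      ∑ l ∈ Finset.range (n + 1), C (M n k * (qBinom q k l * awCoeff a b c d q k l)) *
        ∏ j ∈ Finset.range l, (1 - C (2 * a * q ^ j) * X + C (a ^ 2 * q ^ (2 * j))) := by
    intro k hk
    rw [awPoly_eq hq hq1 hab hac had hw, Finset.mul_sum]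
    simp only [C_mul, mul_assoc]
    refine Finset.sum_subset
      (Finset.range_mono (Nat.succ_le_succ (Nat.lt_succ_iff.mp (Finset.mem_range.mp hk))))
      fun l _ hl => ?_
    rw [qBinom_eq_zero q (show k < l by rw [Finset.mem_range] at hl; omega)]
    simp
  rw [Finset.sum_congr rfl e, Finset.sum_comm, awPoly_eq hq hq1 hab hac (by simp) (by simp)]
  refine Finset.sum_congr rfl fun l hl => ?_
  rw [← Finset.sum_mul, ← map_sum]
  congr 2
  obtain ⟨m, rfl⟩ := Nat.exists_eq_add_of_le (Nat.lt_succ_iff.mp (Finset.mem_range.mp hl))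
  have e1 : ∑ k ∈ Finset.range (l + m + 1),
      M (l + m) k * (qBinom q k l * awCoeff a b c d q k l) =
      ∑ k ∈ Finset.range (l + m + 1), qBinom q (l + m) k * qBinom q k l *
        ((∏ i ∈ Finset.Ico k (l + m), (d / 2 * (1 - a * b * q ^ i) *
          (1 - a * c * q ^ i) * (1 - b * c * q ^ i))) *
          (∏ j ∈ Finset.range (l + m - k), (1 - a * b * c * d * q ^ (2 * k + j)))⁻¹ *
            awCoeff a b c d q k l) := by
    refine Finset.sum_congr rfl fun k _ => ?_
    rw [hM, qBinomDivMat, qBinomMat, Ring.inverse_eq_inv']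
    ring
  rw [e1, sum_qBinom_mul_qBinom (qFactorial_ne_zero hq1)]
  congr 1
  have hs := sum_qBinom_eq_one (q := q) (S := a * d * q ^ l) (T := b * c * q ^ l)
    (fun r => by
      have := hw (2 * l + r)
      rwa [show a * d * q ^ l * (b * c * q ^ l) * q ^ r = a * b * c * d * q ^ (2 * l + r) by ring])
    m
  refine ((mul_one _).symm.trans
    (congrArg (fun t => awCoeff a b c 0 q (l + m) l * t) hs.symm)).trans ?_
  rw [Finset.mul_sum]
  refine Finset.sum_congr rfl fun i hi => ?_
  obtain ⟨r, rfl⟩ := Nat.exists_eq_add_of_le (Nat.lt_succ_iff.mp (Finset.mem_range.mp hi))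
  have e2 : ∏ j ∈ Finset.range r, (1 - a * b * c * d * q ^ (2 * (l + i) + j)) =
      qPoch (a * d * q ^ l * (b * c * q ^ l) * q ^ (2 * i)) q r :=
    Finset.prod_congr rfl fun j _ => by ring
  have e3 : qPochShift q (a * b * c * d * q ^ (2 * l)) i =
      qPochShift q (a * d * q ^ l * (b * c * q ^ l)) i := by
    congr 1; ring
  have e4 : qPoch (b * c * q ^ l * q ^ i) q r =
      ∏ j ∈ Finset.Ico (l + i) (l + (i + r)), (1 - b * c * q ^ j) := by
    rw [← add_assoc, prod_Ico_one_sub, pow_add, mul_assoc (b * c)]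
  have e5 : ∏ j ∈ Finset.Ico (l + i) (l + (i + r)), (d / 2) = d ^ r / 2 ^ r := by
    rw [Finset.prod_const, Nat.card_Ico, ← div_pow]; congr 1; omega
  have e6 : ∀ f : ℕ → K, ∏ j ∈ Finset.Ico l (l + (i + r)), f j =
      (∏ j ∈ Finset.Ico l (l + i), f j) * ∏ j ∈ Finset.Ico (l + i) (l + (i + r)), f j := fun f =>
    (Finset.prod_Ico_consecutive f (by omega) (by omega)).symm
  have e7 : qPochShift q (0 : K) (i + r) = 1 := by
    cases i + r <;> simp [qPochShift, qPoch]
  rw [show l + (i + r) - (l + i) = r by omega, show i + r - i = r by omega, e2, awCoeff, awCoeff,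
    show l + i - l = i by omega, show l + (i + r) - l = i + r by omega, e3, e4]
  simp only [Finset.prod_mul_distrib, e5, mul_zero, zero_mul, sub_zero,
    mul_one, e6, e7, prod_Ico_one_sub (a * d)]
  generalize qPoch (a * d * q ^ l * (b * c * q ^ l) * q ^ (2 * i)) q r = Z
  generalize qPochShift q (a * d * q ^ l * (b * c * q ^ l)) i = Y
  generalize qPoch (a * d * q ^ l) q i = A
  generalize ∏ j ∈ Finset.Ico l (l + i), (1 - a * b * q ^ j) = P1
  generalize ∏ j ∈ Finset.Ico l (l + i), (1 - a * c * q ^ j) = P2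
  generalize ∏ j ∈ Finset.Ico (l + i) (l + (i + r)), (1 - a * b * q ^ j) = P3
  generalize ∏ j ∈ Finset.Ico (l + i) (l + (i + r)), (1 - a * c * q ^ j) = P4
  generalize ∏ j ∈ Finset.Ico (l + i) (l + (i + r)), (1 - b * c * q ^ j) = P5
  clear e e1 hs e2 e3 e4 e5 e6 e7 hM hab hac had hw
  generalize qBinom q (i + r) i = B
  rcases eq_or_ne Z 0 with rfl | hZ
  · simp
  rcases eq_or_ne Y 0 with rfl | hY
  · simp
  field_simp
  ring

end Connection

section Hermite

variable {K : Type*} [Field K]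

/-- The continuous `q`-Hermite polynomials with leading coefficient `2^n`. -/
def hermiteSum (q : K) (n : ℕ) : K[X] :=
  ∑ k ∈ Finset.range (n + 1), C (qBinom q n k) * Chebyshev.T K ((n : ℤ) - 2 * k)

theorem hermitePoly_eq_hermiteSum {q : K} (hq : q ≠ 0) (hq1 : ∀ m : ℕ, q ^ (m + 1) ≠ 1) (n : ℕ) :
    hermitePoly q n = C (1 / 2 ^ n) * hermiteSum q n := by
  rw [hermitePoly, hermiteSum]
  congr 1
  refine Finset.sum_congr rfl fun k hk => ?_
  have hk' := Nat.lt_succ_iff.mp (Finset.mem_range.mp hk)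
  rw [hermite_coeff hq hq1 hk', hermite_coeff_eq_qBinom hq1 hk']

theorem hermiteSum_zero (q : K) : hermiteSum q 0 = 1 := by simp [hermiteSum]

theorem hermiteSum_one (q : K) : hermiteSum q 1 = 2 * X := by
  simp [hermiteSum, Finset.sum_range_succ]; ring

theorem hermiteSum_add_two (q : K) (n : ℕ) :
    hermiteSum q (n + 2) =
      2 * X * hermiteSum q (n + 1) - C (1 - q ^ (n + 1)) * hermiteSum q n := by
  have hT : ∀ m : ℤ, 2 * X * Chebyshev.T K m = Chebyshev.T K (m + 1) + Chebyshev.T K (m - 1) := by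
    intro m
    have := Chebyshev.T_add_two K (m - 1)
    rw [show m - 1 + 2 = m + 1 by ring, show m - 1 + 1 = m by ring] at this
    rw [this]; ring
  have e1 : 2 * X * hermiteSum q (n + 1) =
      ∑ k ∈ Finset.range (n + 2), C (qBinom q (n + 1) (k + 1)) * Chebyshev.T K ((n : ℤ) - 2 * k) +
        Chebyshev.T K ((n : ℤ) + 2) +
      ∑ k ∈ Finset.range (n + 2), C (qBinom q (n + 1) k) * Chebyshev.T K ((n : ℤ) - 2 * k) := by
    have h' : ∑ k ∈ Finset.range (n + 2),
        C (qBinom q (n + 1) k) * Chebyshev.T K ((n : ℤ) + 2 - 2 * k) =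
        ∑ k ∈ Finset.range (n + 2),
          C (qBinom q (n + 1) (k + 1)) * Chebyshev.T K ((n : ℤ) - 2 * k) +
            Chebyshev.T K ((n : ℤ) + 2) := by
      have := Finset.sum_range_succ'
        (fun k : ℕ => C (qBinom q (n + 1) k) * Chebyshev.T K ((n : ℤ) + 2 - 2 * k)) (n + 2)
      rw [Finset.sum_range_succ, qBinom_eq_zero q (show n + 1 < n + 2 by omega)] at this
      simp only [map_zero, zero_mul, add_zero, qBinom_zero_right, map_one, one_mul,
        Nat.cast_zero, mul_zero, sub_zero] at this
      rw [this]
      congr 1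
      refine Finset.sum_congr rfl fun k _ => ?_
      congr 2
      push_cast; ring
    rw [← h', hermiteSum, Finset.mul_sum, ← Finset.sum_add_distrib]
    refine Finset.sum_congr rfl fun k _ => ?_
    rw [mul_left_comm, hT]
    push_cast
    rw [show (n : ℤ) + 1 - 2 * k + 1 = n + 2 - 2 * k by ring,
      show (n : ℤ) + 1 - 2 * k - 1 = n - 2 * k by ring]
    ring
  have e2 : hermiteSum q (n + 2) =
      ∑ k ∈ Finset.range (n + 2),
        C (qBinom q (n + 2) (k + 1)) * Chebyshev.T K ((n : ℤ) - 2 * k) +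
        Chebyshev.T K ((n : ℤ) + 2) := by
    rw [hermiteSum, Finset.sum_range_succ']
    congr 1
    · refine Finset.sum_congr rfl fun k _ => ?_
      congr 2
      push_cast; ring
    · simp
  have e3 : C (1 - q ^ (n + 1)) * hermiteSum q n = ∑ k ∈ Finset.range (n + 2),
      C ((1 - q ^ (n + 1)) * qBinom q n k) * Chebyshev.T K ((n : ℤ) - 2 * k) := by
    rw [Finset.sum_range_succ, qBinom_eq_zero q (Nat.lt_succ_self n), hermiteSum, Finset.mul_sum]
    simp [mul_assoc]
  rw [e1, e2, e3, ← sub_eq_zero]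
  rw [show ∀ A B c D E : K[X], A + c - (B + c + D - E) = A - (B + D - E) from fun _ _ _ _ _ => by
    ring, ← Finset.sum_add_distrib, ← Finset.sum_sub_distrib, ← Finset.sum_sub_distrib]
  refine Finset.sum_eq_zero fun k _ => ?_
  rw [← add_mul, ← sub_mul, ← sub_mul, ← map_add, ← map_sub, ← map_sub]
  have h1 := one_sub_mul_qBinom_succ_succ q n k
  have h2 := qBinom_succ_succ q (n + 1) k
  rw [show qBinom q (n + 2) (k + 1) -
    (qBinom q (n + 1) (k + 1) + qBinom q (n + 1) k - (1 - q ^ (n + 1)) * qBinom q n k) = 0 by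
      linear_combination h2 - h1, map_zero, zero_mul]

/-- The big `q`-Hermite polynomials with leading coefficient `2^n`. -/
def bigHermite (a q : K) (n : ℕ) : K[X] := C (2 ^ n) * awPoly a 0 0 0 q n

/-- The coefficients of `bigHermite` relative to `∏_{j<l} (1 - 2aq^j x + a²q^{2j})`. -/
def bigHermiteCoeff (a q : K) (n l : ℕ) : K :=
  qBinom q n l * ((-1) ^ l * q ^ l.choose 2 * q ^ l / (q ^ n) ^ l) / a ^ n

theorem bigHermite_eq (h2 : (2 : K) ≠ 0) {a q : K} (hq : q ≠ 0)
    (hq1 : ∀ m : ℕ, q ^ (m + 1) ≠ 1) {n m : ℕ} (hm : n ≤ m) :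
    bigHermite a q n = ∑ l ∈ Finset.range (m + 1), C (bigHermiteCoeff a q n l) *
        ∏ j ∈ Finset.range l, (1 - C (2 * a * q ^ j) * X + C (a ^ 2 * q ^ (2 * j))) := by
  rw [← Finset.sum_subset (Finset.range_mono (Nat.succ_le_succ hm)), bigHermite,
    awPoly_eq hq hq1 (by simp) (by simp) (by simp) (by simp), Finset.mul_sum]
  · refine Finset.sum_congr rfl fun l _ => ?_
    rw [← mul_assoc, ← C_mul]
    congr 2
    have e7 : ∀ i, qPochShift q (0 : K) i = 1 := by
      intro i; cases i <;> simp [qPochShift, qPoch]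
    simp only [bigHermiteCoeff, awCoeff, mul_zero, zero_mul, sub_zero, mul_one,
      Finset.prod_const_one, e7, mul_pow]
    have : (2 : K) ^ n ≠ 0 := pow_ne_zero _ h2
    field_simp
  · intro l _ hl
    rw [bigHermiteCoeff, qBinom_eq_zero q (show n < l by rw [Finset.mem_range] at hl; omega)]
    simp

theorem bigHermite_zero (h2 : (2 : K) ≠ 0) {a q : K} (hq : q ≠ 0)
    (hq1 : ∀ m : ℕ, q ^ (m + 1) ≠ 1) : bigHermite a q 0 = 1 := by
  rw [bigHermite_eq h2 hq hq1 le_rfl]; simp [bigHermiteCoeff]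

theorem bigHermite_one (h2 : (2 : K) ≠ 0) {a q : K} (ha : a ≠ 0) (hq : q ≠ 0)
    (hq1 : ∀ m : ℕ, q ^ (m + 1) ≠ 1) : bigHermite a q 1 = 2 * X - C a := by
  rw [bigHermite_eq h2 hq hq1 le_rfl]
  have e1 : bigHermiteCoeff a q 1 1 = -a⁻¹ := by simp [bigHermiteCoeff, hq, neg_div]
  have e2 : bigHermiteCoeff a q 1 0 = a⁻¹ := by simp [bigHermiteCoeff]
  have e3 : a⁻¹ * (2 * a) = 2 := by field_simp
  have e4 : a⁻¹ * a ^ 2 = a := by field_simp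
  have e5 : C a⁻¹ * C (2 * a) = (2 : K[X]) := by rw [← C_mul, e3, map_ofNat]
  have e6 : C a⁻¹ * C (a ^ 2) = C a := by rw [← C_mul, e4]
  simp only [Finset.sum_range_succ, Finset.range_zero, Finset.sum_empty, e1, e2,
    Finset.prod_range_succ, Finset.prod_empty, pow_zero, mul_one, mul_zero, map_neg]
  linear_combination X * e5 - e6

theorem bigHermiteCoeff_succ {a q : K} (ha : a ≠ 0) (hq : q ≠ 0) (n l : ℕ) (hl : l ≤ n + 1) :
    bigHermiteCoeff a q (n + 2) (l + 1) =
      (a⁻¹ * (q ^ (l + 1))⁻¹ + a * q ^ (l + 1) - a * q ^ (n + 1)) *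
          bigHermiteCoeff a q (n + 1) (l + 1) -
        a⁻¹ * (q ^ l)⁻¹ * bigHermiteCoeff a q (n + 1) l -
          (1 - q ^ (n + 1)) * bigHermiteCoeff a q n (l + 1) := by
  obtain ⟨r, hr⟩ := Nat.exists_eq_add_of_le hl
  have h1 : qBinom q (n + 2) (l + 1) = q ^ r * qBinom q (n + 1) l + qBinom q (n + 1) (l + 1) := by
    have := qBinom_succ_succ' q l r
    rwa [← hr] at this
  have h2 : (q ^ (l + 1) - q ^ (n + 1)) * qBinom q (n + 1) (l + 1) =
      (1 - q ^ (n + 1)) * q ^ (l + 1) * qBinom q n (l + 1) := by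
    rcases r with _ | r
    · rw [qBinom_eq_zero q (show n < l + 1 by omega),
        qBinom_eq_zero q (show n + 1 < l + 1 by omega)]
      ring
    · obtain rfl : n = l + r := by omega
      have h3 := qBinom_succ_succ' q l r
      have h4 := one_sub_mul_qBinom_succ_right q l r
      rw [h3]
      linear_combination -q ^ (l + 1) * q ^ r * h4
  have e : q ^ r = q ^ (n + 1) / q ^ l := by
    rw [eq_div_iff (pow_ne_zero _ hq), hr, pow_add]; ring
  rw [e] at h1
  have e4 : (l + 1).choose 2 = l + l.choose 2 := by
    rw [Nat.choose_succ_succ' l 1, Nat.choose_one_right]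
  simp only [bigHermiteCoeff, h1, e4]
  generalize qBinom q (n + 1) l = B0 at *
  generalize qBinom q (n + 1) (l + 1) = B1 at *
  generalize qBinom q n (l + 1) = B2 at *
  have h3 : (1 - q ^ (n + 1)) * B2 = (q ^ (l + 1) - q ^ (n + 1)) * B1 / q ^ (l + 1) := by
    rw [h2]
    field_simp
  rw [← mul_div_assoc (1 - q ^ (n + 1)), ← mul_assoc (1 - q ^ (n + 1)), h3]
  field_simp
  ring

theorem bigHermite_add_two (h2 : (2 : K) ≠ 0) {a q : K} (ha : a ≠ 0) (hq : q ≠ 0)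
    (hq1 : ∀ m : ℕ, q ^ (m + 1) ≠ 1) (n : ℕ) :
    bigHermite a q (n + 2) = (2 * X - C (a * q ^ (n + 1))) * bigHermite a q (n + 1) -
      C (1 - q ^ (n + 1)) * bigHermite a q n := by
  set φ : ℕ → K[X] := fun l =>
    ∏ j ∈ Finset.range l, (1 - C (2 * a * q ^ j) * X + C (a ^ 2 * q ^ (2 * j))) with hφ
  have hX : ∀ l, 2 * X * φ l = C (a⁻¹ * (q ^ l)⁻¹ + a * q ^ l) * φ l -
      C (a⁻¹ * (q ^ l)⁻¹) * φ (l + 1) := by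
    intro l
    have e1 : C (a⁻¹ * (q ^ l)⁻¹) * C (2 * a * q ^ l) = (2 : K[X]) := by
      rw [← C_mul, show a⁻¹ * (q ^ l)⁻¹ * (2 * a * q ^ l) = 2 by field_simp, map_ofNat]
    have e2 : C (a⁻¹ * (q ^ l)⁻¹) * C (a ^ 2 * q ^ (2 * l)) = C (a * q ^ l) := by
      rw [← C_mul]; congr 1; field_simp; ring
    have e3 : φ (l + 1) = φ l * (1 - C (2 * a * q ^ l) * X + C (a ^ 2 * q ^ (2 * l))) := by
      simp only [hφ, Finset.prod_range_succ]
    rw [e3, C_add]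
    linear_combination -φ l * X * e1 + φ l * e2
  have s2 := bigHermite_eq (a := a) h2 hq hq1 (show n + 2 ≤ n + 2 by omega)
  have s1 := bigHermite_eq (a := a) h2 hq hq1 (show n + 1 ≤ n + 1 by omega)
  have s1' := bigHermite_eq (a := a) h2 hq hq1 (show n + 1 ≤ n + 2 by omega)
  have s0 := bigHermite_eq (a := a) h2 hq hq1 (show n ≤ n + 2 by omega)
  have t1 : 2 * X * bigHermite a q (n + 1) =
      ∑ l ∈ Finset.range (n + 3), C ((a⁻¹ * (q ^ l)⁻¹ + a * q ^ l) *
        bigHermiteCoeff a q (n + 1) l) * φ l -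
      ∑ l ∈ Finset.range (n + 2), C (a⁻¹ * (q ^ l)⁻¹ * bigHermiteCoeff a q (n + 1) l) *
        φ (l + 1) := by
    have : bigHermiteCoeff a q (n + 1) (n + 2) = 0 := by
      simp [bigHermiteCoeff, qBinom_eq_zero q (show n + 1 < n + 2 by omega)]
    rw [Finset.sum_range_succ, this, mul_zero, map_zero, zero_mul, add_zero,
      ← Finset.sum_sub_distrib, s1, Finset.mul_sum]
    refine Finset.sum_congr rfl fun l _ => ?_
    change 2 * X * (C _ * φ l) = _
    rw [mul_left_comm, hX]
    simp only [C_mul, C_add]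
    ring
  have c0 : ∀ m, bigHermiteCoeff a q m 0 = (a ^ m)⁻¹ := by simp [bigHermiteCoeff]
  have c1 : C (bigHermiteCoeff a q (n + 2) 0) =
      C ((a⁻¹ * (q ^ 0)⁻¹ + a * q ^ 0) * bigHermiteCoeff a q (n + 1) 0) -
      C (a * q ^ (n + 1)) * C (bigHermiteCoeff a q (n + 1) 0) -
        C (1 - q ^ (n + 1)) * C (bigHermiteCoeff a q n 0) := by
    rw [← C_mul, ← C_mul, ← C_sub, ← C_sub, c0, c0, c0]
    congr 1
    field_simp; ring
  have c2 : ∑ l ∈ Finset.range (n + 2), C (bigHermiteCoeff a q (n + 2) (l + 1)) * φ (l + 1) =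
      ∑ l ∈ Finset.range (n + 2), C ((a⁻¹ * (q ^ (l + 1))⁻¹ + a * q ^ (l + 1)) *
        bigHermiteCoeff a q (n + 1) (l + 1)) * φ (l + 1) -
      ∑ l ∈ Finset.range (n + 2), C (a⁻¹ * (q ^ l)⁻¹ * bigHermiteCoeff a q (n + 1) l) *
        φ (l + 1) -
      C (a * q ^ (n + 1)) * ∑ l ∈ Finset.range (n + 2),
        C (bigHermiteCoeff a q (n + 1) (l + 1)) * φ (l + 1) -
      C (1 - q ^ (n + 1)) * ∑ l ∈ Finset.range (n + 2),
        C (bigHermiteCoeff a q n (l + 1)) * φ (l + 1) := by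
    rw [Finset.mul_sum, Finset.mul_sum, ← Finset.sum_sub_distrib, ← Finset.sum_sub_distrib,
      ← Finset.sum_sub_distrib]
    refine Finset.sum_congr rfl fun l hl => ?_
    rw [bigHermiteCoeff_succ ha hq n l (Nat.lt_succ_iff.mp (Finset.mem_range.mp hl))]
    simp only [C_mul, C_sub, C_add]
    ring
  have shift := fun f : ℕ → K => Finset.sum_range_succ' (fun l => C (f l) * φ l) (n + 2)
  rw [sub_mul, t1, shift, s2.trans (shift _), s1'.trans (shift _), s0.trans (shift _)]
  linear_combination c2 + φ 0 * c1

theorem hermitePoly_connection (h2 : (2 : K) ≠ 0) {a q : K} (ha : a ≠ 0) (hq : q ≠ 0)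
    (hq1 : ∀ m : ℕ, q ^ (m + 1) ≠ 1) (n : ℕ) :
    hermitePoly q n = ∑ k ∈ Finset.range (n + 1),
      C (qBinomMat q (fun _ => a / 2) n k) * awPoly a 0 0 0 q k := by
  have key : ∀ n, ∑ k ∈ Finset.range (n + 1), C (qBinom q n k * a ^ (n - k)) * bigHermite a q k =
      hermiteSum q n := by
    intro n
    induction n using Nat.twoStepInduction with
    | zero => simp [hermiteSum_zero, bigHermite_zero h2 hq hq1]
    | one =>
      simp [Finset.sum_range_succ, hermiteSum_one, bigHermite_zero h2 hq hq1,
        bigHermite_one h2 ha hq hq1]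
    | more n ih0 ih1 =>
      rw [hermiteSum_add_two, ← ih0, ← ih1]
      have e1 : ∑ k ∈ Finset.range (n + 3),
          C (qBinom q (n + 2) k * a ^ (n + 2 - k)) * bigHermite a q k =
          ∑ k ∈ Finset.range (n + 2), C (qBinom q (n + 1) k * a ^ (n + 1 - k)) *
            (bigHermite a q (k + 1) + C (a * q ^ k) * bigHermite a q k) := by
        have h' := Finset.sum_range_succ'
          (fun k => C (q ^ k * qBinom q (n + 1) k * a ^ (n + 2 - k)) * bigHermite a q k) (n + 2)
        rw [Finset.sum_range_succ, qBinom_eq_zero q (show n + 1 < n + 2 by omega)] at h'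
        rw [Finset.sum_range_succ']
        simp only [mul_add, Finset.sum_add_distrib]
        have e3 : ∑ k ∈ Finset.range (n + 2),
            C (qBinom q (n + 2) (k + 1) * a ^ (n + 2 - (k + 1))) * bigHermite a q (k + 1) =
            ∑ k ∈ Finset.range (n + 2),
              C (qBinom q (n + 1) k * a ^ (n + 1 - k)) * bigHermite a q (k + 1) +
            ∑ k ∈ Finset.range (n + 2), C (q ^ (k + 1) * qBinom q (n + 1) (k + 1) *
              a ^ (n + 2 - (k + 1))) * bigHermite a q (k + 1) := by
          rw [← Finset.sum_add_distrib]
          refine Finset.sum_congr rfl fun k _ => ?_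
          rw [qBinom_succ_succ, show n + 2 - (k + 1) = n + 1 - k by omega, ← add_mul, ← C_add]
          congr 2
          ring
        have e4 : ∑ k ∈ Finset.range (n + 2),
            C (qBinom q (n + 1) k * a ^ (n + 1 - k)) * (C (a * q ^ k) * bigHermite a q k) =
            ∑ k ∈ Finset.range (n + 2),
              C (q ^ k * qBinom q (n + 1) k * a ^ (n + 2 - k)) * bigHermite a q k := by
          refine Finset.sum_congr rfl fun k hk => ?_
          have hk' := Finset.mem_range.mp hk
          rw [← mul_assoc, ← C_mul, show n + 2 - k = (n + 1 - k) + 1 by omega]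
          congr 2
          ring
        rw [e3, e4]
        simp only [mul_zero, zero_mul, map_zero, add_zero, pow_zero, qBinom_zero_right, one_mul,
          Nat.sub_zero] at h' ⊢
        linear_combination -h'
      have e2 : C (1 - q ^ (n + 1)) * ∑ k ∈ Finset.range (n + 1),
          C (qBinom q n k * a ^ (n - k)) * bigHermite a q k =
          ∑ k ∈ Finset.range (n + 1), C (qBinom q (n + 1) (k + 1) * a ^ (n + 1 - (k + 1))) *
            (C (1 - q ^ (k + 1)) * bigHermite a q k) := by
        rw [Finset.mul_sum]
        refine Finset.sum_congr rfl fun k _ => ?_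
        have := one_sub_mul_qBinom_succ_succ q n k
        rw [← mul_assoc, ← mul_assoc, ← C_mul, ← C_mul, show n + 1 - (k + 1) = n - k by omega]
        congr 2
        linear_combination -a ^ (n - k) * this
      rw [e1, e2, Finset.mul_sum, Finset.sum_range_succ' _ (n + 1),
        Finset.sum_range_succ' _ (n + 1), add_sub_right_comm, ← Finset.sum_sub_distrib]
      congr 1
      · refine Finset.sum_congr rfl fun k _ => ?_
        rw [bigHermite_add_two h2 ha hq hq1]
        ring
      · rw [zero_add, bigHermite_zero h2 hq hq1, bigHermite_one h2 ha hq hq1]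
        simp
        ring
  rw [hermitePoly_eq_hermiteSum hq hq1, ← key, Finset.mul_sum]
  refine Finset.sum_congr rfl fun k hk => ?_
  obtain ⟨m, rfl⟩ := Nat.exists_eq_add_of_le (Nat.lt_succ_iff.mp (Finset.mem_range.mp hk))
  rw [bigHermite, ← mul_assoc, ← mul_assoc, ← C_mul, ← C_mul, qBinomMat, Finset.prod_const,
    Nat.card_Ico, Nat.add_sub_cancel_left]
  congr 2
  have : (2 : K) ^ m ≠ 0 := pow_ne_zero _ h2
  have h2k : (2 : K) ^ k ≠ 0 := pow_ne_zero _ h2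
  rw [pow_add, div_pow]
  field_simp

end Hermite

section Moments

theorem expansion_trans {R : Type*} [CommRing R] {u v t : ℕ → R[X]} {f g : ℕ → ℕ → R}
    (hg : IsLower g)
    (hf : ∀ n, u n = ∑ k ∈ Finset.range (n + 1), C (f n k) * v k)
    (h : ∀ n, v n = ∑ k ∈ Finset.range (n + 1), C (g n k) * t k) (n : ℕ) :
    u n = ∑ k ∈ Finset.range (n + 1), C (triMul f g n k) * t k := by
  simp only [triMul, map_sum, Finset.sum_mul]
  rw [Finset.sum_comm, hf]
  refine Finset.sum_congr rfl fun j hj => ?_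
  rw [h, Finset.mul_sum]
  have hs : Finset.range (j + 1) ⊆ Finset.range (n + 1) :=
    Finset.range_mono (Nat.succ_le_succ (Nat.lt_succ_iff.mp (Finset.mem_range.mp hj)))
  simp only [C_mul, mul_assoc]
  refine Finset.sum_subset hs fun i _ hi => ?_
  rw [hg (show j < i by rw [Finset.mem_range] at hi; omega)]
  simp

theorem qBinomDivMat_zero {R : Type*} [CommRing R] (q : R) (g : ℕ → R) :
    qBinomDivMat q 0 g = qBinomMat q g := by
  funext n k; simp [qBinomDivMat]

theorem hermitePoly_expansion {K : Type*} [Field K] (h2 : (2 : K) ≠ 0) {a b c d q : K}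
    (ha : a ≠ 0) (hq : q ≠ 0)
    (hq1 : ∀ m : ℕ, q ^ (m + 1) ≠ 1) (hab : ∀ m : ℕ, a * b * q ^ m ≠ 1)
    (hac : ∀ m : ℕ, a * c * q ^ m ≠ 1) (had : ∀ m : ℕ, a * d * q ^ m ≠ 1)
    (hw : ∀ m : ℕ, a * b * c * d * q ^ m ≠ 1) (n : ℕ) :
    hermitePoly q n = ∑ k ∈ Finset.range (n + 1),
      C (triMul (qBinomMat q fun _ => a / 2) (triMul (qBinomMat q fun _ => b / 2)
        (triMul (qBinomMat q fun i => c / 2 * (1 - a * b * q ^ i))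
          (qBinomDivMat q (a * b * c * d) fun i => d / 2 * (1 - a * b * q ^ i) *
            (1 - a * c * q ^ i) * (1 - b * c * q ^ i)))) n k) * awPoly a b c d q k := by
  have s1 : ∀ n, awPoly a 0 0 0 q n = ∑ k ∈ Finset.range (n + 1),
      C (qBinomMat q (fun _ => b / 2) n k) * awPoly a b 0 0 q k := by
    intro n
    rw [awPoly_connection (d := b) h2 ha hq hq1 (by simp) (by simp) hab (by simp)]
    simp only [mul_zero, zero_mul, qBinomDivMat_zero, sub_zero, mul_one]
    exact Finset.sum_congr rfl fun k _ => by rw [awPoly_comm_bd]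
  have s2 : ∀ n, awPoly a b 0 0 q n = ∑ k ∈ Finset.range (n + 1),
      C (qBinomMat q (fun i => c / 2 * (1 - a * b * q ^ i)) n k) * awPoly a b c 0 q k := by
    intro n
    rw [awPoly_connection (d := c) h2 ha hq hq1 hab (by simp) hac (by simp)]
    simp only [mul_zero, zero_mul, qBinomDivMat_zero, sub_zero, mul_one]
    exact Finset.sum_congr rfl fun k _ => by rw [awPoly_comm_cd]
  have s3 := awPoly_connection h2 ha hq hq1 hab hac had hw
  refine expansion_trans ?_ (hermitePoly_connection h2 ha hq hq1) (expansion_trans ?_ s1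
    (expansion_trans ?_ s2 s3)) n
  · exact IsLower.triMul (IsLower.triMul (isLower_qBinomDivMat _ _ _))
  · exact IsLower.triMul (isLower_qBinomDivMat _ _ _)
  · exact isLower_qBinomDivMat _ _ _

section Scaling

variable {R S : Type*} [CommRing R] [CommRing S]

/-- `f'` becomes `s^{n-k} f` under the ring homomorphism `φ`. -/
def IsRescaling (φ : R →+* S) (s : S) (f' : ℕ → ℕ → R) (f : ℕ → ℕ → S) : Prop :=
  ∀ ⦃n k⦄, k ≤ n → φ (f' n k) = s ^ (n - k) * f n k

variable {φ : R →+* S} {s : S}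

theorem IsRescaling.triMul {f' g' : ℕ → ℕ → R} {f g : ℕ → ℕ → S} (hf : IsRescaling φ s f' f)
    (hg : IsRescaling φ s g' g) (hl' : IsLower g') (hl : IsLower g) :
    IsRescaling φ s (triMul f' g') (triMul f g) := by
  intro n k hk
  simp only [AskeyWilson.triMul, map_sum, map_mul, Finset.mul_sum]
  refine Finset.sum_congr rfl fun j hj => ?_
  have hj' := Nat.lt_succ_iff.mp (Finset.mem_range.mp hj)
  rcases lt_or_ge j k with h | h
  · rw [hl h, hl' h, map_zero, mul_zero, mul_zero, mul_zero]
  · rw [hf hj', hg h, show n - k = (n - j) + (j - k) by omega, pow_add]; ring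

theorem isRescaling_qBinomMat {q : R} {g' : ℕ → R} {g : ℕ → S} (hg : ∀ i, φ (g' i) = s * g i) :
    IsRescaling φ s (qBinomMat q g') (qBinomMat (φ q) g) := by
  intro n k _
  rw [qBinomMat, map_mul, qBinom_map, map_prod, Finset.prod_congr rfl fun i _ => hg i,
    Finset.prod_mul_distrib, Finset.prod_const, Nat.card_Ico, qBinomMat]
  ring

theorem map_ring_inverse {x : R} (hx : IsUnit x) : φ (Ring.inverse x) = Ring.inverse (φ x) := by
  obtain ⟨u, rfl⟩ := hx
  rw [Ring.inverse_unit, show φ (u : R) = (Units.map φ.toMonoidHom u : Sˣ) from rfl,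
    Ring.inverse_unit]
  rfl

theorem isRescaling_qBinomDivMat {q w : R} {w' : S} {g' : ℕ → R} {g : ℕ → S}
    (hg : ∀ i, φ (g' i) = s * g i) (hu : ∀ j, IsUnit (1 - w * q ^ j)) (hw : φ w = w') :
    IsRescaling φ s (qBinomDivMat q w g') (qBinomDivMat (φ q) w' g) := by
  intro n k h
  have hu' : IsUnit (∏ j ∈ Finset.range (n - k), (1 - w * q ^ (2 * k + j))) :=
    Finset.prod_induction _ IsUnit (fun _ _ => IsUnit.mul) isUnit_one fun j _ => hu _
  rw [qBinomDivMat, map_mul, isRescaling_qBinomMat hg h, map_ring_inverse hu', qBinomDivMat]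
  simp only [map_prod, map_sub, map_one, map_mul, map_pow, hw]
  ring

end Scaling

/-- `a₁a₂a₃a₄`. -/
def varW : Ser := varA 0 * varA 1 * varA 2 * varA 3

theorem isUnit_one_sub_varW (j : ℕ) : IsUnit (1 - varW * varQ ^ j) := by
  rw [MvPowerSeries.isUnit_iff_constantCoeff]
  simp [varW, varA]

/-- The matrix of the part of the product indexed by quadruples with `t₄ = 0`. -/
def momentHead : ℕ → ℕ → Ser :=
  triMul (triMul (qBinomMat varQ fun _ => varA 0) (qBinomMat varQ fun _ => varA 1))
    (qBinomMat varQ fun i => varA 2 * (1 + varA 0 * varA 1 * varQ ^ i))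

def tailFactor (i : ℕ) : Ser :=
  varA 3 * (1 + varA 0 * varA 1 * varQ ^ i) * (1 + varA 0 * varA 2 * varQ ^ i) *
    (1 + varA 1 * varA 2 * varQ ^ i)

/-- The rescaled mixed moments as power series. -/
def momentSeries : ℕ → ℕ → Ser :=
  triMul momentHead (qBinomDivMat varQ varW tailFactor)

theorem serFrac_two_ne_zero : (2 : SerFrac) ≠ 0 := by
  have h2' : (2 : Ser) ≠ 0 := fun e => by
    have := congrArg MvPowerSeries.constantCoeff e
    rw [map_ofNat, map_zero] at this
    exact two_ne_zero this
  have := (IsFractionRing.injective Ser SerFrac).ne h2'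
  rwa [map_ofNat, map_zero] at this

theorem imag_mul_imag : imag * imag = -1 := by
  rw [imag, ← map_mul, ← map_mul, Complex.I_mul_I]
  simp

theorem imag_ne_zero : imag ≠ 0 := fun h => by
  have := imag_mul_imag
  rw [h, mul_zero] at this
  exact one_ne_zero (neg_eq_zero.mp this.symm)

theorem sigmaAWH_scaled (n k : ℕ) (hkn : k ≤ n) :
    sigmaAWH (scaledA 0) (scaledA 1) (scaledA 2) (scaledA 3) (algebraMap Ser SerFrac varQ) n k =
      triMul (triMul (triMul (qBinomMat (algebraMap Ser SerFrac varQ) fun _ => scaledA 0 / 2)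
        (qBinomMat (algebraMap Ser SerFrac varQ) fun _ => scaledA 1 / 2))
        (qBinomMat (algebraMap Ser SerFrac varQ) fun i =>
          scaledA 2 / 2 * (1 - scaledA 0 * scaledA 1 * algebraMap Ser SerFrac varQ ^ i)))
          (qBinomDivMat (algebraMap Ser SerFrac varQ)
            (scaledA 0 * scaledA 1 * scaledA 2 * scaledA 3) fun i => scaledA 3 / 2 *
            (1 - scaledA 0 * scaledA 1 * algebraMap Ser SerFrac varQ ^ i) *
            (1 - scaledA 0 * scaledA 2 * algebraMap Ser SerFrac varQ ^ i) *
            (1 - scaledA 1 * scaledA 2 * algebraMap Ser SerFrac varQ ^ i)) n k := by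
  have hinj : Function.Injective (algebraMap Ser SerFrac) := IsFractionRing.injective Ser SerFrac
  have hX : ∀ i : Fin 5, (MvPowerSeries.X i : Ser) ≠ 0 := fun i e => by
    have := congrArg (MvPowerSeries.coeff (Finsupp.single i 1)) e
    simp [MvPowerSeries.coeff_X] at this
  have hs : ∀ j, scaledA j = algebraMap Ser SerFrac (MvPowerSeries.C Complex.I * varA j) :=
    fun j => by rw [map_mul]; rfl
  have cA : ∀ j, MvPowerSeries.constantCoeff (varA j) = 0 := fun j => by simp [varA]
  rw [triMul_assoc _ (isLower_qBinomMat _ _), triMul_assoc _ (isLower_qBinomMat _ _)]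
  refine mixedMoment_unique awPoly_scaled_degree
    (hermitePoly_expansion serFrac_two_ne_zero ?_ ?_ (fun m => ?_) (fun m => ?_) (fun m => ?_)
      (fun m => ?_) (fun m => ?_) n) hkn
  · exact mul_ne_zero imag_ne_zero ((map_ne_zero_iff _ hinj).mpr (hX _))
  · exact (map_ne_zero_iff _ hinj).mpr (hX _)
  · rw [← map_pow]
    exact algebraMap_ne_one (by simp [varQ])
  all_goals
    simp only [hs, ← map_mul, ← map_pow]
    exact algebraMap_ne_one (by simp [cA])

theorem rescaledMoment_eq (n k : ℕ) (hkn : k ≤ n) :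
    rescaledMoment n k = algebraMap Ser SerFrac (momentSeries n k) := by
  rw [rescaledMoment, sigmaAWH_scaled n k hkn]
  have h2 := serFrac_two_ne_zero
  have hi := imag_ne_zero
  have hI := imag_mul_imag
  have hA : ∀ j, algebraMap Ser SerFrac (varA j) = 2 / imag * (scaledA j / 2) := fun j => by
    rw [scaledA]; field_simp
  have hAA : ∀ i j, scaledA i * scaledA j = -algebraMap Ser SerFrac (varA i * varA j) :=
    fun i j => by
      rw [scaledA, scaledA, map_mul]
      linear_combination (algebraMap Ser SerFrac (varA i) * algebraMap Ser SerFrac (varA j)) * hI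
  refine (((IsRescaling.triMul (IsRescaling.triMul (IsRescaling.triMul
    (isRescaling_qBinomMat fun _ => hA 0) (isRescaling_qBinomMat fun _ => hA 1)
    (isLower_qBinomMat _ _) (isLower_qBinomMat _ _)) (isRescaling_qBinomMat fun i => ?_)
    (isLower_qBinomMat _ _) (isLower_qBinomMat _ _))
    (isRescaling_qBinomDivMat (fun i => ?_) isUnit_one_sub_varW ?_) (isLower_qBinomDivMat _ _ _)
    (isLower_qBinomDivMat _ _ _)) hkn)).symm
  · rw [hAA, map_mul, hA]
    simp only [map_add, map_one, map_mul, map_pow]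
    ring
  · rw [tailFactor, hAA, hAA, hAA, map_mul, map_mul, map_mul, hA]
    simp only [map_add, map_one, map_mul, map_pow]
    ring
  · rw [varW, mul_assoc (scaledA 0 * scaledA 1), hAA, hAA, neg_mul_neg, ← map_mul]
    congr 1; ring

end Moments

section Chains

open scoped Classical in
/-- The chains with values in a finite set of quadruples. -/
def chainsIn (A : Finset Quad) (n k : ℕ) : Finset (Chain n k) :=
  (Fintype.piFinset fun _ : Finset.Ico k n => A).subtype Antitone

theorem mem_chainsIn {A : Finset Quad} {n k : ℕ} {T : Chain n k} :
    T ∈ chainsIn A n k ↔ ∀ i, T.1 i ∈ A := by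
  classical
  unfold chainsIn
  exact Finset.mem_subtype.trans Fintype.mem_piFinset

/-- The summand of a chain. -/
def chainTerm {n k : ℕ} (T : Chain n k) : Ser :=
  (∏ j : Fin 4, varA j ^ T.s j) * varQ ^ T.norm * qMultinomial n k T.m

/-- The sum over the chains with values in a finite set, as a lower triangular array. -/
def chainSum (A : Finset Quad) (n k : ℕ) : Ser :=
  if k ≤ n then ∑ T ∈ chainsIn A n k, chainTerm T else 0

theorem isLower_chainSum (A : Finset Quad) : IsLower (chainSum A) := fun n k h => by
  rw [chainSum, if_neg (not_le.mpr h)]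

/-- The contribution of the entry `T` at position `i` to the monomial of a chain. -/
def quadMon (i : ℕ) (T : Quad) : Ser :=
  (∏ j : Fin 4, varA j ^ T.t j) * varQ ^ (i * ((T.total - 1) / 2))

theorem prod_quadMon {n k : ℕ} (T : Chain n k) :
    (∏ j : Fin 4, varA j ^ T.s j) * varQ ^ T.norm =
      ∏ i : Finset.Ico k n, quadMon i (T.1 i) := by
  simp only [quadMon, Finset.prod_mul_distrib, Chain.s, Chain.norm, ← Finset.prod_pow_eq_pow_sum]
  rw [Finset.prod_comm]

theorem constantCoeff_qFactorial (n : ℕ) :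
    MvPowerSeries.constantCoeff (qFactorial varQ n) = 1 := by
  simp [qFactorial, varQ, Finset.sum_range_succ']

theorem qFactorial_varQ_ne_zero (n : ℕ) : qFactorial varQ n ≠ 0 := fun h => by
  have := constantCoeff_qFactorial n
  rw [h, map_zero] at this
  exact zero_ne_one this

theorem Chain.prod_m {n k : ℕ} (T : Chain n k) {A : Finset Quad} (hT : ∀ i, T.1 i ∈ A) :
    (T.m.map (qFactorial varQ)).prod =
      ∏ S ∈ A, qFactorial varQ (Finset.univ.filter fun i => T.1 i = S).card := by
  have h : (T.m.map (qFactorial varQ)).prod = ∏ S ∈ Finset.univ.image T.1,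
      qFactorial varQ (Finset.univ.filter fun i => T.1 i = S).card := by
    rw [Chain.m, List.map_map, Finset.prod, ← Finset.sort_eq (Finset.univ.image T.1) (· ≥ ·),
      Multiset.map_coe, Multiset.prod_coe]
    rfl
  rw [h]
  refine Finset.prod_subset (fun S hS => ?_) fun S _ hS => ?_
  · obtain ⟨i, _, rfl⟩ := Finset.mem_image.mp hS
    exact hT i
  · have : (Finset.univ.filter fun i => T.1 i = S).card = 0 := by
      rw [Finset.card_eq_zero, Finset.filter_eq_empty_iff]
      exact fun i _ hi => hS (Finset.mem_image.mpr ⟨i, Finset.mem_univ _, hi⟩)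
    rw [this, qFactorial_zero]

/-- Extend a tuple indexed by `[j, n)` to one indexed by `[k, n)` by the value `x`. -/
def glue {α : Type*} {n j : ℕ} (k : ℕ) (x : α) (T : Finset.Ico j n → α) (i : Finset.Ico k n) : α :=
  if h : (i : ℕ) ∈ Finset.Ico j n then T ⟨i, h⟩ else x

theorem glue_of_le {α : Type*} {n j k : ℕ} (x : α) (T : Finset.Ico j n → α) (i : Finset.Ico k n)
    (h : j ≤ i) :
    glue k x T i = T ⟨i, Finset.mem_Ico.mpr ⟨h, (Finset.mem_Ico.mp i.2).2⟩⟩ :=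
  dif_pos _

theorem glue_of_lt {α : Type*} {n j k : ℕ} (x : α) (T : Finset.Ico j n → α) (i : Finset.Ico k n)
    (h : (i : ℕ) < j) : glue k x T i = x :=
  dif_neg fun h' => absurd (Finset.mem_Ico.mp h').1 (not_le.mpr h)

@[to_additive]
theorem prod_glue {α M : Type*} [CommMonoid M] {n j k : ℕ} (hk : k ≤ j) (hj : j ≤ n) (x : α)
    (T : Finset.Ico j n → α) (f : ℕ → α → M) :
    ∏ i : Finset.Ico k n, f i (glue k x T i) =
      (∏ i ∈ Finset.Ico k j, f i x) * ∏ i : Finset.Ico j n, f i (T i) := by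
  set F : ℕ → M := fun i => if h : i ∈ Finset.Ico j n then f i (T ⟨i, h⟩) else f i x with hF
  have h1 : ∏ i : Finset.Ico k n, f i (glue k x T i) = ∏ i : Finset.Ico k n, F i := by
    refine Finset.prod_congr rfl fun i _ => ?_
    simp only [hF, glue]
    split_ifs <;> rfl
  have h2 : ∏ i : Finset.Ico j n, f i (T i) = ∏ i : Finset.Ico j n, F i :=
    Finset.prod_congr rfl fun i _ => by simp only [hF, dif_pos i.2]
  have h3 : ∏ i ∈ Finset.Ico k j, f i x = ∏ i ∈ Finset.Ico k j, F i :=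
    Finset.prod_congr rfl fun i hi => by
      simp only [hF]
      rw [dif_neg fun h => absurd (Finset.mem_Ico.mp h).1 (not_le.mpr (Finset.mem_Ico.mp hi).2)]
  rw [h1, h2, h3, Finset.prod_coe_sort, Finset.prod_coe_sort, Finset.prod_Ico_consecutive F hk hj]

theorem card_glue {α : Type*} [DecidableEq α] {n j k : ℕ} (hk : k ≤ j) (hj : j ≤ n) (x : α)
    (T : Finset.Ico j n → α) (S : α) :
    (Finset.univ.filter fun i => glue k x T i = S).card =
      (if x = S then j - k else 0) + (Finset.univ.filter fun i => T i = S).card := by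
  rw [Finset.card_filter, Finset.card_filter,
    sum_glue hk hj x T fun _ y => if y = S then 1 else 0]
  split_ifs <;> simp

/-- Put the entry `x` in front of a chain with smaller entries. -/
def Chain.glue {n j : ℕ} (k : ℕ) (x : Quad) (T : Chain n j) (hT : ∀ i, T.1 i ≤ x) : Chain n k :=
  ⟨AskeyWilson.glue k x T.1, fun i i' h => by
    have hh : (i : ℕ) ≤ i' := h
    rcases lt_or_ge (i : ℕ) j with h1 | h1
    · rw [glue_of_lt x T.1 i h1]
      rcases lt_or_ge (i' : ℕ) j with h2 | h2
      · rw [glue_of_lt x T.1 i' h2]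
      · rw [glue_of_le x T.1 i' h2]; exact hT _
    · rw [glue_of_le x T.1 i h1, glue_of_le x T.1 i' (h1.trans hh)]
      exact T.2 hh⟩

theorem Chain.glue_mem_insert {n j k : ℕ} {x : Quad} {A : Finset Quad} (T : Chain n j)
    (hx : ∀ i, T.1 i ≤ x) (hT : ∀ i, T.1 i ∈ A) (i : Finset.Ico k n) :
    (T.glue k x hx).1 i ∈ insert x A := by
  rcases lt_or_ge (i : ℕ) j with h | h
  · exact Finset.mem_insert.mpr (Or.inl (glue_of_lt x T.1 i h))
  · have := glue_of_le x T.1 i h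
    exact Finset.mem_insert_of_mem (this.symm ▸ hT _ : AskeyWilson.glue k x T.1 i ∈ A)

theorem chainTerm_glue {n j k : ℕ} (hk : k ≤ j) (hj : j ≤ n) {x : Quad} {A : Finset Quad}
    (hx : ∀ y ∈ A, y < x) (T : Chain n j) (hT : ∀ i, T.1 i ∈ A) :
    chainTerm (T.glue k x fun i => (hx _ (hT i)).le) =
      chainTerm T * qBinomMat varQ (fun i => quadMon i x) j k := by
  have hxA : x ∉ A := fun h => lt_irrefl _ (hx x h)
  have hP : ((T.glue k x fun i => (hx _ (hT i)).le).m.map (qFactorial varQ)).prod =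
      qFactorial varQ (j - k) * (T.m.map (qFactorial varQ)).prod := by
    rw [Chain.prod_m (A := insert x A), Chain.prod_m T hT, Finset.prod_insert hxA]
    · have c : ∀ S, (Finset.univ.filter fun i =>
          (T.glue k x fun i => (hx _ (hT i)).le).1 i = S).card =
          (if x = S then j - k else 0) + (Finset.univ.filter fun i => T.1 i = S).card :=
        fun S => card_glue hk hj x T.1 S
      congr 1
      · rw [c, if_pos rfl, Finset.card_eq_zero.mpr, add_zero]
        rw [Finset.filter_eq_empty_iff]
        exact fun i _ hi => hxA (hi ▸ hT i)
      · refine Finset.prod_congr rfl fun S hS => ?_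
        rw [c, if_neg (fun h : x = S => hxA (h ▸ hS)), zero_add]
    · exact T.glue_mem_insert _ hT
  have hc : ∀ T : Chain n j, MvPowerSeries.constantCoeff (T.m.map (qFactorial varQ)).prod = 1 := by
    intro T
    rw [map_list_prod, List.map_map]
    refine List.prod_eq_one fun z hz => ?_
    obtain ⟨y, _, rfl⟩ := List.mem_map.mp hz
    exact constantCoeff_qFactorial y
  have hM : qMultinomial n k (T.glue k x fun i => (hx _ (hT i)).le).m =
      qMultinomial n j T.m * qBinom varQ j k := by
    rw [qMultinomial, qMultinomial, hP, mul_assoc]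
    congr 1
    symm
    have hb := qBinom_mul_qFactorial varQ k (j - k)
    rw [Nat.add_sub_cancel' hk] at hb
    rw [MvPowerSeries.eq_inv_iff_mul_eq_one
      (by simp [constantCoeff_qFactorial, hc])]
    have hi := MvPowerSeries.inv_mul_cancel (qFactorial varQ j * (T.m.map (qFactorial varQ)).prod)
      (by simp [constantCoeff_qFactorial, hc])
    rw [← hi, ← hb]
    ring
  rw [chainTerm, chainTerm, hM, prod_quadMon, prod_quadMon, qBinomMat]
  have hg := prod_glue hk hj x T.1 quadMon
  have hg' : ∏ i : Finset.Ico k n, quadMon i ((T.glue k x fun i => (hx _ (hT i)).le).1 i) =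
      (∏ i ∈ Finset.Ico k j, quadMon i x) * ∏ i : Finset.Ico j n, quadMon i (T.1 i) := hg
  rw [hg']
  ring

theorem exists_chain_glue {n k : ℕ} (hkn : k ≤ n) {x : Quad} {A : Finset Quad}
    (hx : ∀ y ∈ A, y < x) (T : Chain n k) (hT : ∀ i, T.1 i ∈ insert x A) :
    ∃ j, k ≤ j ∧ j ≤ n ∧ ∃ (T' : Chain n j) (hT' : ∀ i, T'.1 i ∈ A),
      T'.glue k x (fun i => (hx _ (hT' i)).le) = T := by
  classical
  have hex : ∃ j, k ≤ j ∧ ∀ i : Finset.Ico k n, j ≤ i → T.1 i ≠ x :=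
    ⟨n, hkn, fun i hi => absurd (Finset.mem_Ico.mp i.2).2 (not_lt.mpr hi)⟩
  obtain ⟨hk, hne⟩ := Nat.find_spec hex
  set j := Nat.find hex
  have hjn : j ≤ n := Nat.find_min' hex
    ⟨hkn, fun i hi => absurd (Finset.mem_Ico.mp i.2).2 (not_lt.mpr hi)⟩
  have heq : ∀ i : Finset.Ico k n, (i : ℕ) < j → T.1 i = x := by
    intro i hi
    by_contra hix
    refine Nat.find_min hex hi ⟨(Finset.mem_Ico.mp i.2).1, fun i' hi' h => ?_⟩
    have h1 : T.1 i' ≤ T.1 i := T.2 hi'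
    exact absurd (hx _ (Finset.mem_of_mem_insert_of_ne (hT i) hix)) (not_lt.mpr (h ▸ h1))
  have hmem : ∀ i ∈ Finset.Ico j n, i ∈ Finset.Ico k n := fun i hi =>
    Finset.mem_Ico.mpr ⟨hk.trans (Finset.mem_Ico.mp hi).1, (Finset.mem_Ico.mp hi).2⟩
  refine ⟨j, hk, hjn, ⟨fun i => T.1 ⟨i, hmem _ i.2⟩, fun i i' h => T.2 h⟩, fun i =>
    Finset.mem_of_mem_insert_of_ne (hT _) (hne _ (Finset.mem_Ico.mp i.2).1), ?_⟩
  refine Subtype.ext (funext fun i => ?_)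
  rcases lt_or_ge (i : ℕ) j with h | h
  · exact (glue_of_lt x _ i h).trans (heq i h).symm
  · exact glue_of_le x _ i h

theorem le_of_glue_eq {n k j j' : ℕ} (hk : k ≤ j) {x : Quad} {A : Finset Quad}
    (hx : ∀ y ∈ A, y < x) (T : Chain n j) (hT : ∀ i, T.1 i ∈ A) (T' : Chain n j')
    (hT' : ∀ i, T'.1 i ≤ x)
    (h : T.glue k x (fun i => (hx _ (hT i)).le) = T'.glue k x hT') (hj' : j' ≤ n) :
    j' ≤ j := by
  by_contra hlt
  rw [not_le] at hlt
  have hi : j ∈ Finset.Ico k n := Finset.mem_Ico.mpr ⟨hk, hlt.trans_le hj'⟩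
  have h1 := congrFun (congrArg Subtype.val h) ⟨j, hi⟩
  have h2 := glue_of_le (k := k) x T.1 ⟨j, hi⟩ le_rfl
  have h3 := glue_of_lt (k := k) x T'.1 ⟨j, hi⟩ hlt
  have h4 := h2.symm.trans (h1.trans h3)
  exact lt_irrefl x (by conv_lhs => rw [← h4]
                        exact hx _ (hT _))

theorem chainSum_insert {x : Quad} {A : Finset Quad} (hx : ∀ y ∈ A, y < x) :
    chainSum (insert x A) =
      triMul (chainSum A) (qBinomMat varQ fun i => quadMon i x) := by
  funext n k
  rcases lt_or_ge n k with h | h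
  · rw [isLower_chainSum _ h, (isLower_qBinomMat _ _).triMul h]
  have e : triMul (chainSum A) (qBinomMat varQ fun i => quadMon i x) n k =
      ∑ j ∈ Finset.Icc k n, ∑ T ∈ chainsIn A n j,
        chainTerm T * qBinomMat varQ (fun i => quadMon i x) j k := by
    rw [triMul]
    symm
    refine (Finset.sum_congr rfl fun j hj => ?_).trans (Finset.sum_subset (fun j hj => ?_)
      fun j hj hj' => ?_)
    · rw [chainSum, if_pos (Finset.mem_Icc.mp hj).2, Finset.sum_mul]
    · rw [Finset.mem_Icc] at hj; rw [Finset.mem_range]; omega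
    · rw [isLower_qBinomMat _ _ (show j < k by
        rw [Finset.mem_Icc] at hj'; rw [Finset.mem_range] at hj; omega), mul_zero]
  rw [e, Finset.sum_sigma', chainSum, if_pos h]
  symm
  have hmem : ∀ p : (j : ℕ) × Chain n j, p ∈ (Finset.Icc k n).sigma (fun j => chainsIn A n j) →
      (k ≤ p.1 ∧ p.1 ≤ n) ∧ ∀ i, p.2.1 i ∈ A := fun p hp =>
    ⟨Finset.mem_Icc.mp (Finset.mem_sigma.mp hp).1, mem_chainsIn.mp (Finset.mem_sigma.mp hp).2⟩
  refine Finset.sum_bij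
    (fun p hp => p.2.glue k x fun i => (hx _ ((hmem p hp).2 i)).le) ?_ ?_ ?_ ?_
  · intro p hp
    exact mem_chainsIn.mpr (p.2.glue_mem_insert _ (hmem p hp).2)
  · rintro ⟨j, T⟩ hp ⟨j', T'⟩ hp' heq
    obtain ⟨⟨hk, hj⟩, hT⟩ := hmem _ hp
    obtain ⟨⟨hk', hj'⟩, hT'⟩ := hmem _ hp'
    obtain rfl : j = j' := le_antisymm
      (le_of_glue_eq hk' hx T' hT' T (fun i => (hx _ (hT i)).le) heq.symm hj)
      (le_of_glue_eq hk hx T hT T' (fun i => (hx _ (hT' i)).le) heq hj')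
    congr 1
    refine Subtype.ext (funext fun i => ?_)
    have hi := Finset.mem_Ico.mp i.2
    have hi' : (i : ℕ) ∈ Finset.Ico k n := Finset.mem_Ico.mpr ⟨hk.trans hi.1, hi.2⟩
    have h1 := congrFun (congrArg Subtype.val heq) ⟨i, hi'⟩
    exact (glue_of_le x T.1 ⟨i, hi'⟩ hi.1).symm.trans (h1.trans (glue_of_le x T'.1 ⟨i, hi'⟩ hi.1))
  · intro T hT
    obtain ⟨j, hk, hj, T', hT', rfl⟩ := exists_chain_glue h hx T (mem_chainsIn.mp hT)
    exact ⟨⟨j, T'⟩, Finset.mem_sigma.mpr ⟨Finset.mem_Icc.mpr ⟨hk, hj⟩, mem_chainsIn.mpr hT'⟩, rfl⟩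
  · intro p hp
    exact (chainTerm_glue (hmem p hp).1.1 (hmem p hp).1.2 hx p.2 (hmem p hp).2).symm

theorem chainSum_empty_self (n : ℕ) : chainSum ∅ n n = 1 := by
  have hempty : IsEmpty (Finset.Ico n n) := ⟨fun i => by simpa using i.2⟩
  set T₀ : Chain n n := ⟨fun i => hempty.elim i, fun i => hempty.elim i⟩
  have h : chainsIn ∅ n n = {T₀} := by
    ext T
    rw [mem_chainsIn, Finset.mem_singleton]
    exact ⟨fun _ => Subtype.ext (funext fun i => hempty.elim i), fun _ i => hempty.elim i⟩
  rw [chainSum, if_pos le_rfl, h, Finset.sum_singleton, chainTerm, prod_quadMon, qMultinomial,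
    Chain.prod_m T₀ (A := ∅) fun i => hempty.elim i]
  rw [Finset.univ_eq_empty, Finset.prod_empty, Finset.prod_empty, mul_one, one_mul,
    MvPowerSeries.mul_inv_cancel _ (by simp [constantCoeff_qFactorial])]

theorem triMul_chainSum_empty (g : ℕ → ℕ → Ser) : triMul (chainSum ∅) g = g := by
  funext n k
  rw [triMul, Finset.sum_eq_single n]
  · rw [chainSum_empty_self, one_mul]
  · intro j hj hjn
    have hjn' : j < n := by rw [Finset.mem_range] at hj; omega
    rw [chainSum, if_pos hjn'.le, Finset.sum_eq_zero, zero_mul]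
    intro T hT
    exact absurd (mem_chainsIn.mp hT ⟨j, Finset.mem_Ico.mpr ⟨le_rfl, hjn'⟩⟩)
      (Finset.notMem_empty _)
  · intro h
    exact absurd (Finset.mem_range.mpr (Nat.lt_succ_self n)) h

end Chains

section Levels

theorem Quad.lt_iff {S T : Quad} : S < T ↔ S.t 3 < T.t 3 ∨ S.t 3 = T.t 3 ∧
    (S.t 2 < T.t 2 ∨ S.t 2 = T.t 2 ∧ (S.t 1 < T.t 1 ∨ S.t 1 = T.t 1 ∧ T.t 0 < S.t 0)) := by
  change S.key < T.key ↔ _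
  simp only [Quad.key, Prod.Lex.toLex_lt_toLex, neg_lt_neg_iff, Nat.cast_lt]

/-- Add `l` to all entries. -/
def Quad.shift (T : Quad) (l : ℕ) : Quad where
  t j := T.t j + l
  odd_sum := by
    have h := T.odd_sum
    simp only [Fin.sum_univ_four, Nat.odd_iff] at h ⊢
    omega
  close i j := by
    have := T.close i j
    push_cast
    rwa [add_sub_add_right_eq_sub]

/-- The quadruples with `t₄ = 0`, in increasing order. -/
def headQuad : Fin 4 → Quad := ![
  ⟨![1, 0, 0, 0], by decide, by decide⟩, ⟨![0, 1, 0, 0], by decide, by decide⟩,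
  ⟨![0, 0, 1, 0], by decide, by decide⟩, ⟨![1, 1, 1, 0], by decide, by decide⟩]

/-- The quadruples with `t₄ = 1`, in increasing order. -/
def tailQuad : Fin 8 → Quad := ![
  ⟨![0, 0, 0, 1], by decide, by decide⟩, ⟨![1, 1, 0, 1], by decide, by decide⟩,
  ⟨![1, 0, 1, 1], by decide, by decide⟩, ⟨![2, 1, 1, 1], by decide, by decide⟩,
  ⟨![0, 1, 1, 1], by decide, by decide⟩, ⟨![1, 2, 1, 1], by decide, by decide⟩,
  ⟨![1, 1, 2, 1], by decide, by decide⟩, ⟨![2, 2, 2, 1], by decide, by decide⟩]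

/-- The quadruples with `t₄ ≤ l`. -/
def quadLevel : ℕ → Finset Quad
  | 0 => insert (headQuad 3) (insert (headQuad 2) (insert (headQuad 1) (insert (headQuad 0) ∅)))
  | l + 1 => insert ((tailQuad 7).shift l) (insert ((tailQuad 6).shift l)
      (insert ((tailQuad 5).shift l) (insert ((tailQuad 4).shift l) (insert ((tailQuad 3).shift l)
        (insert ((tailQuad 2).shift l) (insert ((tailQuad 1).shift l)
          (insert ((tailQuad 0).shift l) (quadLevel l))))))))

theorem Quad.eq_iff {S T : Quad} :
    S = T ↔ S.t 0 = T.t 0 ∧ S.t 1 = T.t 1 ∧ S.t 2 = T.t 2 ∧ S.t 3 = T.t 3 := by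
  rw [Quad.ext_iff, funext_iff, Fin.forall_fin_succ, Fin.forall_fin_succ, Fin.forall_fin_succ,
    Fin.forall_fin_one]
  rfl

theorem Quad.le_add_one (T : Quad) (i j : Fin 4) : T.t i ≤ T.t j + 1 := by
  have := (abs_le.mp (T.close i j)).2
  omega

theorem mem_quadLevel {l : ℕ} {T : Quad} : T ∈ quadLevel l ↔ T.t 3 ≤ l := by
  have h := T.odd_sum
  rw [Nat.odd_iff, Fin.sum_univ_four] at h
  have h01 := T.le_add_one 0 1
  have h02 := T.le_add_one 0 2
  have h03 := T.le_add_one 0 3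
  have h10 := T.le_add_one 1 0
  have h12 := T.le_add_one 1 2
  have h13 := T.le_add_one 1 3
  have h20 := T.le_add_one 2 0
  have h21 := T.le_add_one 2 1
  have h23 := T.le_add_one 2 3
  have h30 := T.le_add_one 3 0
  have h31 := T.le_add_one 3 1
  have h32 := T.le_add_one 3 2
  induction l with
  | zero =>
    simp only [quadLevel, Finset.mem_insert, Quad.eq_iff, headQuad, Matrix.cons_val]
    simp
    omega
  | succ l ih =>
    simp only [quadLevel, Finset.mem_insert, ih, Quad.eq_iff, Quad.shift, tailQuad,
      Matrix.cons_val]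
    refine ⟨by rintro (h | h | h | h | h | h | h | h | h) <;> omega, fun hl => ?_⟩
    rcases Nat.lt_or_ge l (T.t 3) with h3 | h3
    · obtain ⟨x, hx, ex⟩ : ∃ x < 3, T.t 0 = x + l := ⟨T.t 0 - l, by omega, by omega⟩
      obtain ⟨y, hy, ey⟩ : ∃ y < 3, T.t 1 = y + l := ⟨T.t 1 - l, by omega, by omega⟩
      obtain ⟨z, hz, ez⟩ : ∃ z < 3, T.t 2 = z + l := ⟨T.t 2 - l, by omega, by omega⟩
      have ew : T.t 3 = 1 + l := by omega
      simp only [ex, ey, ez, ew, Nat.add_right_cancel_iff] at h01 h10 h02 h20 h12 h21 h ⊢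
      clear h03 h30 h13 h31 h23 h32 ih
      interval_cases x <;> interval_cases y <;> interval_cases z <;> first | omega | simp
    · simp only [h3, or_true]

theorem quadMon_shift (i l : ℕ) (T : Quad) :
    quadMon i (T.shift l) = quadMon i T * (varW * varQ ^ (2 * i)) ^ l := by
  have h : ((T.shift l).total - 1) / 2 = (T.total - 1) / 2 + 2 * l := by
    have h1 : (T.shift l).total = T.total + 4 * l := by
      simp only [Quad.total, Quad.shift, Fin.sum_univ_four]; ring
    have h2 := T.odd_sum
    rw [Nat.odd_iff] at h2
    change T.total % 2 = 1 at h2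
    omega
  rw [quadMon, quadMon, h]
  simp only [Fin.prod_univ_four, Quad.shift, varW, pow_add, mul_pow, mul_add]
  ring

theorem triMul_qBinomMat_pair (f : ℕ → ℕ → Ser) {g g' g'' : ℕ → Ser} (y : Ser)
    (h' : ∀ i, g' i = g i * (y * varQ ^ i)) (h'' : ∀ i, g'' i = g i * (1 + y * varQ ^ i)) :
    triMul (triMul f (qBinomMat varQ g)) (qBinomMat varQ g') = triMul f (qBinomMat varQ g'') := by
  have : IsDomain Ser := NoZeroDivisors.to_isDomain _
  rw [triMul_assoc _ (isLower_qBinomMat _ _), funext h', funext h'',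
    qBinomMat_triMul qFactorial_varQ_ne_zero]

theorem quadMon_headQuad (i : ℕ) :
    quadMon i (headQuad 0) = varA 0 ∧ quadMon i (headQuad 1) = varA 1 ∧
    quadMon i (headQuad 2) = varA 2 ∧
    quadMon i (headQuad 3) = varA 2 * (varA 0 * varA 1 * varQ ^ i) := by
  refine ⟨?_, ?_, ?_, ?_⟩ <;>
    simp [quadMon, headQuad, Quad.total, Fin.sum_univ_four, Fin.prod_univ_four]
  ring

theorem quadMon_tailQuad (i : ℕ) :
    quadMon i (tailQuad 0) = varA 3 ∧
    quadMon i (tailQuad 1) = varA 3 * (varA 0 * varA 1 * varQ ^ i) ∧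
    quadMon i (tailQuad 2) = varA 3 * (varA 0 * varA 2 * varQ ^ i) ∧
    quadMon i (tailQuad 3) = varA 3 * (varA 0 * varA 2 * varQ ^ i) * (varA 0 * varA 1 * varQ ^ i) ∧
    quadMon i (tailQuad 4) = varA 3 * (varA 1 * varA 2 * varQ ^ i) ∧
    quadMon i (tailQuad 5) = varA 3 * (varA 1 * varA 2 * varQ ^ i) * (varA 0 * varA 1 * varQ ^ i) ∧
    quadMon i (tailQuad 6) = varA 3 * (varA 1 * varA 2 * varQ ^ i) * (varA 0 * varA 2 * varQ ^ i) ∧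
    quadMon i (tailQuad 7) = varA 3 * (varA 1 * varA 2 * varQ ^ i) * (varA 0 * varA 2 * varQ ^ i) *
      (varA 0 * varA 1 * varQ ^ i) := by
  refine ⟨?_, ?_, ?_, ?_, ?_, ?_, ?_, ?_⟩ <;>
    simp [quadMon, tailQuad, Quad.total, Fin.sum_univ_four, Fin.prod_univ_four] <;> ring

end Levels

section Levels

theorem headQuad_lt {i j : Fin 4} (h : i < j) : headQuad i < headQuad j := by
  rw [Quad.lt_iff]
  revert i j
  decide

theorem tailQuad_shift_lt (l : ℕ) {i j : Fin 8} (h : i < j) :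
    (tailQuad i).shift l < (tailQuad j).shift l := by
  have h' : tailQuad i < tailQuad j := by
    rw [Quad.lt_iff]
    revert i j
    decide
  rw [Quad.lt_iff] at h' ⊢
  simp only [Quad.shift]
  omega

theorem lt_tailQuad_shift {l : ℕ} {T : Quad} (h : T ∈ quadLevel l) (i : Fin 8) :
    T < (tailQuad i).shift l := by
  rw [Quad.lt_iff]
  have h1 : (tailQuad i).t 3 = 1 := by revert i; decide
  have h2 := mem_quadLevel.mp h
  simp only [Quad.shift, h1]
  omega

theorem forall_mem_insert_lt {x y : Quad} {A : Finset Quad} (hy : y < x) (h : ∀ z ∈ A, z < x) :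
    ∀ z ∈ insert y A, z < x := fun z hz => by
  rcases Finset.mem_insert.mp hz with rfl | hz
  exacts [hy, h z hz]

theorem chainSum_quadLevel_zero : chainSum (quadLevel 0) = momentHead := by
  have lt : ∀ {i j : Fin 4}, i < j → headQuad i < headQuad j := headQuad_lt
  have nil : ∀ x : Quad, ∀ z ∈ (∅ : Finset Quad), z < x := fun _ _ h =>
    absurd h (Finset.notMem_empty _)
  have ins := @forall_mem_insert_lt
  rw [quadLevel, chainSum_insert (ins (lt (by decide)) (ins (lt (by decide))
      (ins (lt (by decide)) (nil _)))),
    chainSum_insert (ins (lt (by decide)) (ins (lt (by decide)) (nil _))),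
    chainSum_insert (ins (lt (by decide)) (nil _)), chainSum_insert (nil _),
    triMul_chainSum_empty]
  simp only [(quadMon_headQuad _).1, (quadMon_headQuad _).2.1, (quadMon_headQuad _).2.2.1,
    (quadMon_headQuad _).2.2.2]
  exact triMul_qBinomMat_pair _ (varA 0 * varA 1) (fun _ => rfl) (fun _ => rfl)

theorem chainSum_quadLevel_succ (l : ℕ) : chainSum (quadLevel (l + 1)) =
    triMul (chainSum (quadLevel l))
      (qBinomMat varQ fun i => tailFactor i * (varW * varQ ^ (2 * i)) ^ l) := by
  have lt : ∀ {i j : Fin 8}, i < j → (tailQuad i).shift l < (tailQuad j).shift l :=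
    tailQuad_shift_lt l
  have nil : ∀ i : Fin 8, ∀ z ∈ quadLevel l, z < (tailQuad i).shift l := fun i z h =>
    lt_tailQuad_shift h i
  have ins := @forall_mem_insert_lt
  have c0 := nil 0
  have c1 := ins (lt (show 0 < 1 by decide)) (nil 1)
  have c2 := ins (lt (show 1 < 2 by decide)) (ins (lt (show 0 < 2 by decide)) (nil 2))
  have c3 := ins (lt (show 2 < 3 by decide)) (ins (lt (show 1 < 3 by decide))
    (ins (lt (show 0 < 3 by decide)) (nil 3)))
  have c4 := ins (lt (show 3 < 4 by decide)) (ins (lt (show 2 < 4 by decide))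
    (ins (lt (show 1 < 4 by decide)) (ins (lt (show 0 < 4 by decide)) (nil 4))))
  have c5 := ins (lt (show 4 < 5 by decide)) (ins (lt (show 3 < 5 by decide))
    (ins (lt (show 2 < 5 by decide)) (ins (lt (show 1 < 5 by decide))
    (ins (lt (show 0 < 5 by decide)) (nil 5)))))
  have c6 := ins (lt (show 5 < 6 by decide)) (ins (lt (show 4 < 6 by decide))
    (ins (lt (show 3 < 6 by decide)) (ins (lt (show 2 < 6 by decide))
    (ins (lt (show 1 < 6 by decide)) (ins (lt (show 0 < 6 by decide)) (nil 6))))))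
  have c7 := ins (lt (show 6 < 7 by decide)) (ins (lt (show 5 < 7 by decide))
    (ins (lt (show 4 < 7 by decide)) (ins (lt (show 3 < 7 by decide))
    (ins (lt (show 2 < 7 by decide)) (ins (lt (show 1 < 7 by decide))
    (ins (lt (show 0 < 7 by decide)) (nil 7)))))))
  rw [quadLevel, chainSum_insert c7, chainSum_insert c6, chainSum_insert c5, chainSum_insert c4,
    chainSum_insert c3, chainSum_insert c2, chainSum_insert c1, chainSum_insert c0]
  have hq := fun i => quadMon_tailQuad i
  obtain ⟨E, hE⟩ : ∃ E : ℕ → Ser, ∀ i, (varW * varQ ^ (2 * i)) ^ l = E i := ⟨_, fun _ => rfl⟩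
  simp only [quadMon_shift, hE]
  rw [triMul_qBinomMat_pair _ (varA 0 * varA 1) (g := fun i => quadMon i (tailQuad 0) * E i)
      (g'' := fun i => varA 3 * E i * (1 + varA 0 * varA 1 * varQ ^ i))
      (fun i => by rw [(hq i).1, (hq i).2.1]; ring) (fun i => by rw [(hq i).1]),
    triMul_qBinomMat_pair _ (varA 0 * varA 1) (g := fun i => quadMon i (tailQuad 2) * E i)
      (g'' := fun i => varA 3 * E i * (1 + varA 0 * varA 1 * varQ ^ i) *
        (varA 0 * varA 2 * varQ ^ i))
      (fun i => by rw [(hq i).2.2.1, (hq i).2.2.2.1]; ring)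
      (fun i => by rw [(hq i).2.2.1]; ring),
    triMul_qBinomMat_pair _ (varA 0 * varA 1) (g := fun i => quadMon i (tailQuad 4) * E i)
      (g'' := fun i => varA 3 * E i * (1 + varA 0 * varA 1 * varQ ^ i) *
        (varA 1 * varA 2 * varQ ^ i))
      (fun i => by rw [(hq i).2.2.2.2.1, (hq i).2.2.2.2.2.1]; ring)
      (fun i => by rw [(hq i).2.2.2.2.1]; ring),
    triMul_qBinomMat_pair _ (varA 0 * varA 1) (g := fun i => quadMon i (tailQuad 6) * E i)
      (g'' := fun i => varA 3 * E i * (1 + varA 0 * varA 1 * varQ ^ i) *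
        (varA 1 * varA 2 * varQ ^ i) * (varA 0 * varA 2 * varQ ^ i))
      (fun i => by rw [(hq i).2.2.2.2.2.2.1, (hq i).2.2.2.2.2.2.2]; ring)
      (fun i => by rw [(hq i).2.2.2.2.2.2.1]; ring),
    triMul_qBinomMat_pair _ (varA 0 * varA 2)
      (g := fun i => varA 3 * E i * (1 + varA 0 * varA 1 * varQ ^ i))
      (g'' := fun i => varA 3 * E i * (1 + varA 0 * varA 1 * varQ ^ i) *
        (1 + varA 0 * varA 2 * varQ ^ i))
      (fun i => by ring) (fun i => by ring),
    triMul_qBinomMat_pair _ (varA 0 * varA 2)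
      (g'' := fun i => varA 3 * E i * (1 + varA 0 * varA 1 * varQ ^ i) *
        (1 + varA 0 * varA 2 * varQ ^ i) * (varA 1 * varA 2 * varQ ^ i))
      (fun i => by ring) (fun i => by ring),
    triMul_qBinomMat_pair _ (varA 1 * varA 2)
      (g'' := fun i => tailFactor i * E i)
      (fun i => by ring) (fun i => by rw [tailFactor]; ring)]

theorem momentSeries_eq (l : ℕ) : momentSeries = triMul (chainSum (quadLevel l))
    (qBinomDivMat varQ varW fun i => tailFactor i * (varW * varQ ^ (2 * i)) ^ l) := by
  have : IsDomain Ser := NoZeroDivisors.to_isDomain _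
  induction l with
  | zero => simp only [pow_zero, mul_one, chainSum_quadLevel_zero]; rfl
  | succ l ih =>
    rw [chainSum_quadLevel_succ, triMul_assoc _ (isLower_qBinomMat _ _), ih,
      ← qBinomDivMat_eq_triMul qFactorial_varQ_ne_zero isUnit_one_sub_varW]
    simp only [pow_succ, mul_assoc]

theorem coeff_momentSeries {n k : ℕ} (hkn : k ≤ n) {e : Fin 5 →₀ ℕ} {l : ℕ}
    (hl : e (Fin.castSucc 3) < l) :
    MvPowerSeries.coeff e (momentSeries n k) =
      MvPowerSeries.coeff e (chainSum (quadLevel l) n k) := by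
  rw [momentSeries_eq l, triMul, map_sum, Finset.sum_eq_single k]
  · rw [qBinomDivMat_self, mul_one]
  · intro j _ hj
    rcases lt_or_gt_of_ne hj with hj | hj
    · rw [isLower_qBinomDivMat _ _ _ hj, mul_zero, map_zero]
    · refine MvPowerSeries.X_pow_dvd_iff.mp ?_ e hl
      refine Dvd.dvd.mul_left ?_ _
      rw [qBinomDivMat_mul]
      refine Dvd.dvd.mul_left ?_ _
      refine Dvd.dvd.trans ?_ (Finset.dvd_prod_of_mem _ (Finset.mem_Ico.mpr ⟨le_rfl, hj⟩))
      refine pow_dvd_pow_of_dvd ?_ l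
      exact Dvd.intro_left (varA 0 * varA 1 * varA 2) rfl |>.mul_right _
  · intro h
    exact absurd (Finset.mem_range.mpr (Nat.lt_succ_of_le hkn)) h

theorem coeff_chainTerm_eq_zero {n k : ℕ} {T : Chain n k} {e : Fin 5 →₀ ℕ} {l : ℕ}
    (hl : e (Fin.castSucc 3) ≤ l) (hT : T ∉ chainsIn (quadLevel l) n k) :
    MvPowerSeries.coeff e (chainTerm T) = 0 := by
  rw [mem_chainsIn] at hT
  push Not at hT
  obtain ⟨i, hi⟩ := hT
  rw [mem_quadLevel, not_le] at hi
  have hs : (T.1 i).t 3 ≤ T.s 3 :=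
    Finset.single_le_sum (f := fun i => (T.1 i).t 3) (fun _ _ => Nat.zero_le _)
      (Finset.mem_univ i)
  have hd : (MvPowerSeries.X (Fin.castSucc 3) : Ser) ^ T.s 3 ∣ chainTerm T :=
    ((Finset.dvd_prod_of_mem (fun j => varA j ^ T.s j) (Finset.mem_univ 3)).mul_right _).mul_right _
  exact MvPowerSeries.X_pow_dvd_iff.mp hd e (by omega)

end Levels

end

end AskeyWilson

theorem mainTheorem4 (n k : ℕ) (hkn : k ≤ n) :
    ∃ F : AskeyWilson.Ser,
      AskeyWilson.IsFormalSum
        (fun T : AskeyWilson.Chain n k =>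
          (∏ j : Fin 4, AskeyWilson.varA j ^ T.s j) * AskeyWilson.varQ ^ T.norm *
            AskeyWilson.qMultinomial n k T.m) F ∧
      AskeyWilson.rescaledMoment n k = algebraMap AskeyWilson.Ser AskeyWilson.SerFrac F := by
  refine ⟨AskeyWilson.momentSeries n k, fun e => ?_, AskeyWilson.rescaledMoment_eq n k hkn⟩
  have hsub : (Function.support fun T : AskeyWilson.Chain n k =>
      MvPowerSeries.coeff e (AskeyWilson.chainTerm T)) ⊆
      AskeyWilson.chainsIn (AskeyWilson.quadLevel (e (Fin.castSucc 3) + 1)) n k := fun T hT => by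
    by_contra h
    exact hT (AskeyWilson.coeff_chainTerm_eq_zero (Nat.le_succ _) h)
  refine ⟨(Finset.finite_toSet _).subset hsub, ?_⟩
  rw [AskeyWilson.coeff_momentSeries hkn (Nat.lt_succ_self _), AskeyWilson.chainSum, if_pos hkn,
    map_sum]
  exact (finsum_eq_sum_of_support_subset _ hsub).symm
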